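/- **Setting.** Let $n>1$, let $\varepsilon_1,\dots,\varepsilon_n$ be the standard basis vectors, $\Delta=\{\varepsilon_r-\varepsilon_s: r\ne s\in[1,n]\}$, $\alpha_i=\varepsilon_i-\varepsilon_{i+1}$ and $\pi=\{\alpha_1,\dots,\alpha_{n-1}\}$. Let $\mathscr J^+,\mathscr J^-$ be two partitions of $[1,n]$ into intervals and let $\pi^\pm$ be the set of $\alpha_i$ such that $i,i+1$ lie in the same part of $\mathscr J^\pm$. Assume $\pi^+\cup\pi^-=\pi$ and $\pi^+\cap\pi^-\neq\pi$. Put $R=(\mathbb N\pi^+\cup-\mathbb N\pi^-)\cap\Delta$ and $K=\Delta\setminus R$; a root is called nil if it lies in $K\cup -K$. **Markings.** For each part $[p,q]$ of $\mathscr J^+$ (resp. $\mathscr J^-$) draw above (resp. below) a horizontal line the half-integer arcs joining $i+\frac12$ and $j+\frac12$ for $p\le i\le j<q$, $i+j+1=p+q$. On the set of half-integer points $\frac32,\dots,n-\frac12$ these arcs decompose into connected components. Mark exactly one arc of each component; if the component contains an arc joining a point to itself (above or below), the marked arc must be such an arc. Marking the half-integer arc from $i+\frac12$ to $j+\frac12$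 marks the integer arc from $i$ to $j+1$ on the same side. **Modified involutions.** Let $[p,q]$ be a part of $\mathscr J^\pm$, $\kappa(i)=p+q-i$ on $[p,q]$ (and the identity elsewhere), and let $\mathscr M\subset[p,q]$ be the set of left ends of its marked integer arcs. For a connected component $[u,v]$ of $\mathscr M$ put $v^-=v$ if $2v+1=p+q$ and $v^-=v+1$ otherwise, and $\mathscr M_{u,v}=[u,v^-]\cup\kappa([u,v^-])$. Let $\sigma^\pm$ be any involution of $[1,n]$ which, on each part, equals $\kappa$ outside the sets $\mathscr M_{u,v}$, and restricts to each $\mathscr M_{u,v}$ as an anti-Toeplitz involution: it stabilizes $\mathscr M_{u,v}$; $\mathscr M_{u,v}$ is a single orbit of $\langle\kappa,\sigma^\pm\rangle$, which is a loop if $2v+2<p+q$ and an edge otherwise; and every two-element orbit of $\sigma^\pm$ in $\mathscr M_{u,v}$ has one point in $[u,v^-]$ and the other in $\kappa([u,v^-])$. Here an orbit of the group generated by two involutions $f,g$ is called an edge if it is also an orbit of $\langle fg\rangle$, and a loop otherwise. Let $S$ consist of the roots $\varepsilon_i-\varepsilon_{\sigma^+(i)}$ with $i<\sigma^+(i)$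 and $\varepsilon_i-\varepsilon_{\sigma^-(i)}$ with $i>\sigma^-(i)$. **An edge.** Let $E$ be a non-trivial edge of $\langle\sigma^+,\sigma^-\rangle$ (that is $e:=|E|>1$), with a chosen starting point $a\in E$ fixed by $\sigma^+$ or $\sigma^-$. Let $\varphi(1)=a,\varphi(2),\dots,\varphi(e)$ be the enumeration of $E$ obtained by applying $\sigma^-,\sigma^+,\sigma^-,\dots$ successively if $\sigma^+(a)=a$, and $\sigma^+,\sigma^-,\sigma^+,\dots$ otherwise. Put $\beta_i=\varepsilon_{\varphi(i)}-\varepsilon_{\varphi(i+1)}$ for $1\le i\le e-1$, and let $\epsilon_i\in\{\pm1\}$ be the sign with $\epsilon_i\beta_i\in S$. Let $S_E$ be the set of elements $\varepsilon_u-\varepsilon_v$ of $S$ with $u,v\in E$. The points $\varphi(1),\varphi(e)$ and the internal turning points, i.e. the $\varphi(t)$ with $1<t<e$ and $\varphi(t)$ strictly between $\varphi(t-1)$ and $\varphi(t+1)$, are the turning points. A turning point $\varphi(t)$ is a source (type $A$) if $\epsilon_t=1$ (when $t<e$) and $\epsilon_{t-1}=-1$ (when $t>1$), and a sink (type $B$)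 if $\epsilon_t=-1$ (when $t<e$) and $\epsilon_{t-1}=1$ (when $t>1$). **Signatures and external arcs.** To each internal turning point $\varphi(t)$ assign a signature $sg(t)\in\{\pm1\}$ such that $sg(t)=1$ if $\beta_t$ is nil, $sg(t)=-1$ if $\beta_{t-1}$ is nil and $\beta_t$ is not, and $sg(t)$ is arbitrary if neither is nil. ($\beta_{t-1}$ is marked and assigned to $\varphi(t)$ if $sg(t)=1$, and $\beta_t$ if $sg(t)=-1$.) * If $sg(t)=-1$, let $r<t$ be maximal such that $\varphi(r)$ is an internal turning point of the same type as $\varphi(t)$ with $sg(r)=-1$, let $s>r$ be minimal such that $\varphi(s)$ is a turning point of the opposite type (if no such $r$ exists, let $s\ge1$ be minimal such), and put $\beta^*_t=\epsilon_t\bigl(\beta_t+\sum_{k=s}^{t-1}\beta_k\bigr)$. * If $sg(t)=1$, let $s>t$ be minimal such that $\varphi(s)$ is a turning point of the opposite type, and put $\beta^*_{t-1}=\epsilon_{t-1}\bigl(\beta_{t-1}+\sum_{k=t}^{s-1}\beta_k\bigr)$. * For all other $i\in[1,e-1]$ put $\beta^*_i=\epsilon_i\beta_i$. **Proposition.** For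 all choices as above, $S_E=\{\epsilon_i\beta_i:1\le i\le e-1\}$, and $\Pi^*=\{\beta^*_i:1\le i\le e-1\}$ is a simple root system of type $A_{e-1}$, namely a system of simple roots of $\{\varepsilon_u-\varepsilon_v:u\neq v\in E\}$ with $e-1$ elements and Cartan matrix of type $A_{e-1}$, such that a) $\epsilon_i\beta_i\in\mathbb N\Pi^*$ for all $i\in[1,e-1]$; b) if $\beta^*_i\neq\epsilon_i\beta_i$, then $\beta^*_i\in K$. -/

import Mathlib

namespace Straightening

noncomputable section

/-! ### Roots of `sl_n`

Points of the line `L` are the natural numbers `1, …, n`; weights are integer vectors `ℕ → ℤ` in the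
usual coordinates, so that `ε_i` is the `i`-th basis vector. Of the two sides of `L`, `true` is the
upper one (superscript `+`) and `false` the lower one (superscript `-`). -/

/-- The weight `ε_r - ε_s`; a root when `r ≠ s`, drawn as an arrow from `r` to `s`. -/
def root (r s : ℕ) : ℕ → ℤ := Pi.single r 1 - Pi.single s 1

/-- The simple root `α_i = ε_i - ε_{i+1}`, located at the half-integer point `i + 1/2`. -/
def simpleRoot (i : ℕ) : ℕ → ℤ := root i (i + 1)

/-- The roots `ε_u - ε_v` with `u ≠ v` in `X`; for `X` of cardinality `e` this is a root system
of type `A_{e-1}`. -/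
def rootsOn (X : Set ℕ) : Set (ℕ → ℤ) := {γ | ∃ u ∈ X, ∃ v ∈ X, u ≠ v ∧ γ = root u v}

/-- The root system `Δ` of `sl_n`. -/
def Delta (n : ℕ) : Set (ℕ → ℤ) := rootsOn (Set.Icc 1 n)

/-- The standard scalar product on weights of `sl_n`. -/
def scalar (n : ℕ) (γ δ : ℕ → ℤ) : ℤ := ∑ i ∈ Finset.Icc 1 n, γ i * δ i

/-- `ℕ Π`: the sums of elements of `Π`. -/
def natSpan (Pi : Set (ℕ → ℤ)) : Set (ℕ → ℤ) := AddSubmonoid.closure Pi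

/-- `Π` is a system of simple roots of the set of roots `Φ`. -/
structure IsSimpleSystem (Φ Pi : Set (ℕ → ℤ)) : Prop where
  subset : Pi ⊆ Φ
  linearIndependent : LinearIndependent ℤ (Subtype.val : Pi → ℕ → ℤ)
  pos_or_neg : ∀ γ ∈ Φ, γ ∈ natSpan Pi ∨ -γ ∈ natSpan Pi

/-- `Π` has `m` elements and its Cartan matrix, for a suitable enumeration, is that of type `A_m`.
All roots have square length `2`, so Cartan integers are scalar products. -/
def IsOfTypeA (n m : ℕ) (Pi : Set (ℕ → ℤ)) : Prop :=
  ∃ b : Fin m ≃ Pi, ∀ j k, scalar n (b j) (b k) = CartanMatrix.A m j k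

/-! ### Partitions of `[1, n]` and the biparabolic -/

/-- All parts of the partition are connected, i.e. intervals. -/
def IsConnectedPartition {n : ℕ} (P : Finpartition (Finset.Icc 1 n)) : Prop :=
  ∀ B ∈ P.parts, ∃ p q, B = Finset.Icc p q

/-- The indices `i` of the simple roots `α_i` joining two neighbours of the same part. -/
def simpleIndices {n : ℕ} (P : Finpartition (Finset.Icc 1 n)) : Set ℕ :=
  {i | ∃ B ∈ P.parts, i ∈ B ∧ i + 1 ∈ B}

/-- `R = (ℕ π⁺ ∪ -ℕ π⁻) ∩ Δ`. -/
def rootsR {n : ℕ} (J : Bool → Finpartition (Finset.Icc 1 n)) : Set (ℕ → ℤ) :=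
  {γ | γ ∈ Delta n ∧ (γ ∈ natSpan (simpleRoot '' simpleIndices (J true)) ∨
    -γ ∈ natSpan (simpleRoot '' simpleIndices (J false)))}

/-- `K = Δ \ R`. -/
def rootsK {n : ℕ} (J : Bool → Finpartition (Finset.Icc 1 n)) : Set (ℕ → ℤ) :=
  Delta n \ rootsR J

/-- A root is nil if it lies in `K ∪ -K`. -/
def IsNil {n : ℕ} (J : Bool → Finpartition (Finset.Icc 1 n)) (γ : ℕ → ℤ) : Prop :=
  γ ∈ rootsK J ∨ -γ ∈ rootsK J

/-! ### Meanders -/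

/-- A meander of two involutions is an orbit of the group they generate. -/
def IsMeander (f g : Equiv.Perm ℕ) (E : Set ℕ) : Prop :=
  ∃ x, E = MulAction.orbit (Subgroup.closure {f, g}) x

/-- An edge is a meander which is also an orbit of the group generated by the product. -/
def IsEdge (f g : Equiv.Perm ℕ) (E : Set ℕ) : Prop :=
  IsMeander f g E ∧ ∃ x, E = MulAction.orbit (Subgroup.zpowers (f * g)) x

/-- A loop is a meander which is not an edge. -/
def IsLoop (f g : Equiv.Perm ℕ) (E : Set ℕ) : Prop := IsMeander f g E ∧ ¬ IsEdge f g E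

/-! ### Half-integer arcs and their markings -/

/-- The half-integer arc joining `i + 1/2` and `j + 1/2`, `i ≤ j`, belongs to the link pattern which
reverses the simple roots `α_p, …, α_{q-1}` of every part `[p, q]`. -/
def IsHalfArc {n : ℕ} (P : Finpartition (Finset.Icc 1 n)) (i j : ℕ) : Prop :=
  ∃ p q, Finset.Icc p q ∈ P.parts ∧ p ≤ i ∧ i ≤ j ∧ i + j + 1 = p + q

/-- `i + 1/2` and `j + 1/2` lie on the same half-integer meander. (Fictitious arcs only join the two
free ends of one chain of genuine arcs to each other, possibly through an added fictitious point, or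
a free end to itself if the other end of its chain is a genuine fixed point; so they do not change
which points of `π` share a meander.) -/
def SameHalfMeander {n : ℕ} (J : Bool → Finpartition (Finset.Icc 1 n)) : ℕ → ℕ → Prop :=
  Relation.EqvGen fun i j => ∃ b, IsHalfArc (J b) i j

/-- The half-integer meander of `i + 1/2` is an edge: it contains a point which is fixed by one of
the two half-integer involutions. (A chain with a fictitious fixed point has a genuine one at its
other end.) -/
def HalfMeanderIsEdge {n : ℕ} (J : Bool → Finpartition (Finset.Icc 1 n)) (i : ℕ) : Prop :=
  ∃ j, SameHalfMeander J i j ∧ ∃ b, IsHalfArc (J b) j j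

/-- `M b` is the set of left ends `i` of the marked half-integer arcs on the side `b`. Exactly one
genuine (non-fictitious) arc is marked on every half-integer meander, and if the meander is an edge
then the marked arc is an end, that is joins a fixed point to itself. Marking the half-integer arc
from `i + 1/2` to `j + 1/2` is the same as marking the integer arc from `i` to `j + 1`. -/
structure IsMarking {n : ℕ} (J : Bool → Finpartition (Finset.Icc 1 n)) (M : Bool → Set ℕ) :
    Prop where
  isArc : ∀ b, ∀ i ∈ M b, ∃ j, IsHalfArc (J b) i j
  existsUnique : ∀ k ∈ Set.Ico 1 n, ∃! x : Bool × ℕ, x.2 ∈ M x.1 ∧ SameHalfMeander J k x.2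
  isEnd : ∀ b, ∀ i ∈ M b, HalfMeanderIsEdge J i → IsHalfArc (J b) i i

/-! ### Modified involutions -/

/-- The reflection `i ↦ p + q - i` of `[p, q]`, extended by the identity. -/
def reflectFun (p q i : ℕ) : ℕ := if p ≤ i ∧ i ≤ q then p + q - i else i

theorem reflectFun_involutive (p q : ℕ) : Function.Involutive (reflectFun p q) := by
  intro i
  unfold reflectFun
  split_ifs <;> omega

/-- The integer involution `κ_J` of `J = [p, q]`. -/
def kappa (p q : ℕ) : Equiv.Perm ℕ := (reflectFun_involutive p q).toPerm

/-- `[u, v]` is a connected component of the set of markings of the part `[p, q]`. -/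
def IsMarkComponent (M : Set ℕ) (p q u v : ℕ) : Prop :=
  p ≤ u ∧ u ≤ v ∧ v ≤ q ∧ (∀ i ∈ Set.Icc u v, i ∈ M) ∧ (p < u → u - 1 ∉ M) ∧ (v < q → v + 1 ∉ M)

/-- The left half of the extended component of `[u, v]`: it is `[u, v + 1]`, except that it is
`[u, v]` when `v` is adjacent to the non-integer centre of `[p, q]`. -/
def extLeft (p q u v : ℕ) : Set ℕ := Set.Icc u (if 2 * v + 1 = p + q then v else v + 1)

/-- The right half of the extended component. -/
def extRight (p q u v : ℕ) : Set ℕ := kappa p q '' extLeft p q u v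

/-- The extended component of `[u, v]`. -/
def extComponent (p q u v : ℕ) : Set ℕ := extLeft p q u v ∪ extRight p q u v

/-- `σ` restricts to an anti-Toeplitz involution of the extended component of `[u, v]`. The first
alternative in `meander` is the one where `v` is not the innermost arc of `[p, q]`. -/
structure IsAntiToeplitz (p q u v : ℕ) (σ : Equiv.Perm ℕ) : Prop where
  mapsTo : ∀ x ∈ extComponent p q u v, σ x ∈ extComponent p q u v
  meander : if 2 * v + 2 < p + q then IsLoop (kappa p q) σ (extComponent p q u v)
    else IsEdge (kappa p q) σ (extComponent p q u v)
  opposite : ∀ x ∈ extComponent p q u v, σ x ≠ x →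
    (x ∈ extLeft p q u v ∧ σ x ∈ extRight p q u v) ∨
      (x ∈ extRight p q u v ∧ σ x ∈ extLeft p q u v)

/-- `σ` is a modified involution for the partition `P` with the markings `M`: on every part it is
anti-Toeplitz on the extended components of the markings and the reflection elsewhere. -/
structure IsModifiedInvolution {n : ℕ} (P : Finpartition (Finset.Icc 1 n)) (M : Set ℕ)
    (σ : Equiv.Perm ℕ) : Prop where
  involutive : ∀ i, σ (σ i) = i
  outside : ∀ i, i ∉ Set.Icc 1 n → σ i = i
  unmodified : ∀ p q, Finset.Icc p q ∈ P.parts → ∀ i ∈ Set.Icc p q,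
    (∀ u v, IsMarkComponent M p q u v → i ∉ extComponent p q u v) → σ i = kappa p q i
  modified : ∀ p q, Finset.Icc p q ∈ P.parts → ∀ u v, IsMarkComponent M p q u v →
    IsAntiToeplitz p q u v σ

/-- `S = S⁺ ∪ S⁻`: arcs above the line point from left to right, arcs below from right to left. -/
def rootsS (σ : Bool → Equiv.Perm ℕ) : Set (ℕ → ℤ) :=
  {γ | ∃ i, i < σ true i ∧ γ = root i (σ true i)} ∪
    {γ | ∃ i, σ false i < i ∧ γ = root i (σ false i)}

/-- `S_E`: the elements of `S` given by arcs with both end-points in `E`. -/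
def rootsSOn (σ : Bool → Equiv.Perm ℕ) (E : Set ℕ) : Set (ℕ → ℤ) := rootsS σ ∩ rootsOn E

/-! ### Following an edge

`a` is the starting point and `e` the number of points of an edge. -/

/-- The side of the arc joining `φ(t)` to `φ(t + 1)`: the first one is below if `a` is fixed by
`σ⁺` and above otherwise, and sides alternate. -/
def stepSide (σ : Bool → Equiv.Perm ℕ) (a t : ℕ) : Bool :=
  if (σ true a = a ↔ Odd t) then false else true

/-- The enumeration `φ(1) = a, φ(2), …, φ(e)` of the edge (the value at `0` is irrelevant). -/
def phi (σ : Bool → Equiv.Perm ℕ) (a : ℕ) : ℕ → ℕ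
  | 0 => a
  | 1 => a
  | t + 2 => σ (stepSide σ a (t + 1)) (phi σ a (t + 1))

/-- `β_i = ε_{φ(i)} - ε_{φ(i+1)}`. -/
def beta (σ : Bool → Equiv.Perm ℕ) (a i : ℕ) : ℕ → ℤ := root (phi σ a i) (phi σ a (i + 1))

open Classical in
/-- The sign `ϵ_i` with `ϵ_i β_i ∈ S`. -/
def eps (σ : Bool → Equiv.Perm ℕ) (a i : ℕ) : ℤ := if beta σ a i ∈ rootsS σ then 1 else -1

/-- `ι_I = ∑ β_i` over the interval `I_{s,t} = [s, t - 1]`. -/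
def intervalValue (σ : Bool → Equiv.Perm ℕ) (a s t : ℕ) : ℕ → ℤ := ∑ i ∈ Finset.Ico s t, beta σ a i

/-- `φ(t)` is an internal turning point. -/
def IsInternalTurning (σ : Bool → Equiv.Perm ℕ) (a e t : ℕ) : Prop :=
  1 < t ∧ t < e ∧
    ((phi σ a (t - 1) < phi σ a t ∧ phi σ a t < phi σ a (t + 1)) ∨
      (phi σ a (t + 1) < phi σ a t ∧ phi σ a t < phi σ a (t - 1)))

/-- `φ(t)` is a turning point: an end-point or an internal turning point. -/
def IsTurning (σ : Bool → Equiv.Perm ℕ) (a e t : ℕ) : Prop :=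
  t = 1 ∨ t = e ∨ IsInternalTurning σ a e t

/-- The turning point `φ(t)` is a source (type `A`): the arrows of all arcs meeting it leave it. -/
def IsSource (σ : Bool → Equiv.Perm ℕ) (a e t : ℕ) : Prop :=
  IsTurning σ a e t ∧ (t < e → eps σ a t = 1) ∧ (1 < t → eps σ a (t - 1) = -1)

/-- The turning point `φ(t)` is a sink (type `B`): the arrows of all arcs meeting it enter it. -/
def IsSink (σ : Bool → Equiv.Perm ℕ) (a e t : ℕ) : Prop :=
  IsTurning σ a e t ∧ (t < e → eps σ a t = -1) ∧ (1 < t → eps σ a (t - 1) = 1)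

/-- `φ(s)` and `φ(t)` are turning points of the same type. -/
def SameType (σ : Bool → Equiv.Perm ℕ) (a e s t : ℕ) : Prop :=
  (IsSource σ a e s ∧ IsSource σ a e t) ∨ (IsSink σ a e s ∧ IsSink σ a e t)

/-- `φ(s)` and `φ(t)` are turning points of opposite types. -/
def OppositeType (σ : Bool → Equiv.Perm ℕ) (a e s t : ℕ) : Prop :=
  (IsSource σ a e s ∧ IsSink σ a e t) ∨ (IsSink σ a e s ∧ IsSource σ a e t)

/-! ### Signatures, external arcs and the new simple system -/

/-- At an internal turning point `φ(t)` the boundary value `β_{t-1}` is marked if `sg t = 1` and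
`β_t` is marked if `sg t = -1`. If exactly one of the two is nil, the other one is marked; if both
are nil, `β_{t-1}` is marked; if none is nil, the choice is free. -/
structure IsSignature {n : ℕ} (J : Bool → Finpartition (Finset.Icc 1 n))
    (σ : Bool → Equiv.Perm ℕ) (a e : ℕ) (sg : ℕ → ℤ) : Prop where
  sign : ∀ t, IsInternalTurning σ a e t → sg t = 1 ∨ sg t = -1
  both : ∀ t, IsInternalTurning σ a e t →
    IsNil J (beta σ a (t - 1)) → IsNil J (beta σ a t) → sg t = 1
  upper : ∀ t, IsInternalTurning σ a e t →
    IsNil J (beta σ a (t - 1)) → ¬ IsNil J (beta σ a t) → sg t = -1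
  lower : ∀ t, IsInternalTurning σ a e t →
    ¬ IsNil J (beta σ a (t - 1)) → IsNil J (beta σ a t) → sg t = 1

/-- The internal turning points of the same type as `φ(t)` and of negative signature which lie
strictly above `φ(t)` on the vertical line, that is have a smaller index. -/
def negativeAbove (σ : Bool → Equiv.Perm ℕ) (a e : ℕ) (sg : ℕ → ℤ) (t : ℕ) : Set ℕ :=
  {r | r < t ∧ IsInternalTurning σ a e r ∧ SameType σ a e r t ∧ sg r = -1}

open Classical in
/-- The index `s` of the turning point `φ(s)` crossed by the external arc assigned to an internal
turning point `φ(t)` of negative signature: the first turning point of the opposite type, going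
down, after the nearest member of `negativeAbove` if there is one, and on the whole edge
otherwise. -/
def crossedNeg (σ : Bool → Equiv.Perm ℕ) (a e : ℕ) (sg : ℕ → ℤ) (t : ℕ) : ℕ :=
  if (negativeAbove σ a e sg t).Nonempty then
    sInf {s | sSup (negativeAbove σ a e sg t) < s ∧ OppositeType σ a e s t}
  else sInf {s | OppositeType σ a e s t}

/-- The index `s` of the turning point `φ(s)` crossed by the external arc assigned to an internal
turning point `φ(t)` of positive signature: the first one of the opposite type below `φ(t)`. -/
def crossedPos (σ : Bool → Equiv.Perm ℕ) (a e t : ℕ) : ℕ :=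
  sInf {s | t < s ∧ OppositeType σ a e s t}

open Classical in
/-- `β*_i`: a marked value is replaced by the value of the external arc assigned to the same
turning point, and an unmarked one is kept, as `ϵ_i β_i`. -/
def betaStar (σ : Bool → Equiv.Perm ℕ) (a e : ℕ) (sg : ℕ → ℤ) (i : ℕ) : ℕ → ℤ :=
  if IsInternalTurning σ a e i ∧ sg i = -1 then
    eps σ a i • (beta σ a i + intervalValue σ a (crossedNeg σ a e sg i) i)
  else if IsInternalTurning σ a e (i + 1) ∧ sg (i + 1) = 1 then
    eps σ a i • (beta σ a i + intervalValue σ a (i + 1) (crossedPos σ a e (i + 1)))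
  else eps σ a i • beta σ a i

/-- `Π* = {β*_i : 1 ≤ i ≤ e - 1}`. -/
def PiStar (σ : Bool → Equiv.Perm ℕ) (a e : ℕ) (sg : ℕ → ℤ) : Set (ℕ → ℤ) :=
  betaStar σ a e sg '' Set.Ico 1 e

end

end Straightening

open Straightening

namespace Straightening

/-! Everything reduces to finding a directed path. Suppose the elements of `PiStar` are the
differences of consecutive entries of a repetition-free list running through `E`. Then they form the
standard simple system of type $A$ for that ordering of `E`, and (a) says only that every original
arrow goes from an earlier entry to a later one. The existence of the list is a statement about
abstract zigzags, that is paths $1,\dots,e$ whose steps are directed forwards or backwards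
(`exists_list_links_eq`).

The list is built by inserting $1,2,\dots,e$ in turn. It is kept, up to reversal, in the order for
which the current step points forwards, together with one slot for the next point. On a straight run
the slot follows the point just inserted. At a turning point of negative signature the list is
reversed and the slot moves to its far end; the entry found there is the point crossed by the
external arc. At a turning point $t$ of positive signature the list is reversed too, but the slot
lies between $t$ and $t-1$. The new arc $t-1$ then stays pending until the next point of opposite
type arrives, and that point is the one crossed. The invariant is `IsSlotted`. It survives provided
that no negative turning point is followed at once by a positive one.

The geometry of the markings supplies this proviso and (b). The key is `before_of_opposite`: within
one part, a turning point and a point of opposite type come in an order dictated by the side. If the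
involution of that side moves both, this holds because modified involutions exchange the two halves
of a part. A fixed point may lie in the wrong half, but then all arcs between it and the centre are
marked. If the order failed, the centre of a part on the other side would produce a half-integer
meander with two marks, or with a mark that is not an end.

The orders required on the two sides are opposite, so two consecutive turning points cannot share
parts on both sides: the root joining them is nil, which gives the proviso. For (b), the external
arc joins the crossed point $z$ to a neighbour $y$ of a turning point $x$. If it were in $R$ and the
root joining $x,y$ were not nil, the same clash of orders would occur. If that root is nil, the
signature rule makes both roots at $x$ nil; the run from $x$ to $z$ then leaves the part containing
$x$ and $y$ and cannot return (`before_crossedPos`). -/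

/-! ### Consecutive entries of a list -/

/-- The pairs of consecutive entries of a list. -/
def links : List ℕ → Set (ℕ × ℕ)
  | [] => ∅
  | [_] => ∅
  | x :: y :: l => insert (x, y) (links (y :: l))

theorem links_append_cons (A : List ℕ) (x : ℕ) (B : List ℕ) :
    links (A ++ x :: B) = links (A ++ [x]) ∪ links (x :: B) := by
  induction A with
  | nil => simp [links]
  | cons y A ih =>
    cases A with
    | nil => ext p; simp [links]
    | cons z A =>
      simp only [List.cons_append, links] at ih ⊢
      rw [ih, Set.insert_union]

theorem links_reverse (l : List ℕ) : links l.reverse = Prod.swap '' links l := by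
  induction l with
  | nil => simp [links]
  | cons x l ih =>
    cases l with
    | nil => simp [links]
    | cons y l =>
      have h : (x :: y :: l).reverse = l.reverse ++ y :: [x] := by simp
      rw [h, links_append_cons, ← List.reverse_cons, ih]
      simp only [links, Set.image_insert_eq, Prod.swap_prod_mk]
      ext p; simp

/-- The pair `(x, y)`, reversed when `b` is false. -/
def orient (b : Bool) (p : ℕ × ℕ) : ℕ × ℕ := if b then p else p.swap

theorem orient_orient (b : Bool) (p : ℕ × ℕ) : orient b (orient b p) = p := by
  cases b <;> simp [orient]

theorem swap_orient (b : Bool) (p : ℕ × ℕ) : (orient b p).swap = orient (!b) p := by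
  cases b <;> simp [orient]

theorem orient_not_mk (b : Bool) (x y : ℕ) : orient (!b) (x, y) = orient b (y, x) := by
  cases b <;> simp [orient]

theorem swap_image_orient_image (b : Bool) (X : Set (ℕ × ℕ)) :
    Prod.swap '' (orient b '' X) = orient (!b) '' X := by
  rw [Set.image_image]
  simp only [swap_orient]

/-! ### Zigzags

A path `1, …, e` whose `i`-th step points forwards if `d i` is true and backwards otherwise. -/

/-- The direction of the steps changes at the interior point `t`. -/
def Turns (e : ℕ) (d : ℕ → Bool) (t : ℕ) : Prop := 1 < t ∧ t < e ∧ d (t - 1) ≠ d t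

/-- All steps at `t` leave it (`b = true`), respectively enter it (`b = false`). -/
def HasType (e : ℕ) (d : ℕ → Bool) (b : Bool) (t : ℕ) : Prop :=
  1 ≤ t ∧ t ≤ e ∧ (t < e → d t = b) ∧ (1 < t → d (t - 1) = !b)

/-- `s` is the first point of type `b` beyond all turning points of the opposite type in `N` up
to `m`. -/
def IsFirstBeyond (e : ℕ) (d : ℕ → Bool) (N : ℕ → Prop) (m : ℕ) (b : Bool) (s : ℕ) : Prop :=
  IsLeast {s | HasType e d b s ∧ ∀ r ≤ m, Turns e d r → N r → d r = !b → r < s} s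

open Classical in
/-- The `i`-th step after straightening the turning points: `N` is the set of turning points of
negative signature, `cn` and `cp` are the points crossed by external arcs. -/
noncomputable def newArc (e : ℕ) (d : ℕ → Bool) (N : ℕ → Prop) (cn cp : ℕ → ℕ) (i : ℕ) : ℕ × ℕ :=
  if Turns e d i ∧ N i then orient (d i) (cn i, i + 1)
  else if Turns e d (i + 1) ∧ ¬ N (i + 1) then orient (d i) (i, cp (i + 1))
  else orient (d i) (i, i + 1)

open Classical in
/-- The starting point of the `m`-th new arc. -/
noncomputable def slotPoint (e : ℕ) (d : ℕ → Bool) (N : ℕ → Prop) (cn : ℕ → ℕ) (m : ℕ) : ℕ :=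
  if Turns e d m ∧ N m then cn m else m

/-- A partially straightened zigzag on `1, …, m`: the points are listed, up to reversal, as
`F.reverse ++ B` and the point `m + 1` is to be inserted between the two parts. Any link across
the gap belongs to the `t - 1`-st new arc, where `t` is the last turning point. -/
structure IsSlotted (e : ℕ) (d : ℕ → Bool) (N : ℕ → Prop) (cn cp : ℕ → ℕ) (m : ℕ)
    (F B : List ℕ) : Prop where
  head : F.head? = some (slotPoint e d N cn m)
  nodup : (F.reverse ++ B).Nodup
  mem : ∀ x, x ∈ F.reverse ++ B ↔ 1 ≤ x ∧ x ≤ m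
  self_mem : m ∈ F
  last : ∀ s, F.getLast? = some s → IsFirstBeyond e d N m (d m) s
  order : ∀ i, 1 ≤ i → i < m →
    if d i = d m then [i, i + 1].Sublist (F.reverse ++ B) else [i + 1, i].Sublist (F.reverse ++ B)
  links_eq :
    (B = [] ∧ links F.reverse = orient (d m) '' (newArc e d N cn cp '' Set.Ico 1 m) ∧
      ∀ s ≤ m, HasType e d (!d m) s → ∃ r ≤ m, Turns e d r ∧ N r ∧ d r = d m ∧ s < r) ∨
    ∃ t, t ≤ m ∧ Turns e d t ∧ ¬ N t ∧ (∀ k, t ≤ k → k ≤ m → d k = d m) ∧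
      B.head? = some (t - 1) ∧
      (∀ s, B.getLast? = some s → IsFirstBeyond e d N m (!d m) s) ∧
      links F.reverse ∪ links B =
        orient (d m) '' (newArc e d N cn cp '' (Set.Ico 1 m \ {t - 1}))

theorem links_reverse_append_cons {F : List ℕ} {c : ℕ} (h : F.head? = some c) (x : ℕ)
    (B : List ℕ) : links (F.reverse ++ x :: B) = links F.reverse ∪ {(c, x)} ∪ links (x :: B) := by
  cases F with
  | nil => simp at h
  | cons f F =>
    obtain rfl : f = c := by simpa using h
    rw [List.reverse_cons, List.append_assoc, List.singleton_append, links_append_cons,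
      Set.union_assoc]
    ext p; simp [links]

theorem links_cons_of_head? {B : List ℕ} {y : ℕ} (h : B.head? = some y) (x : ℕ) :
    links (x :: B) = {(x, y)} ∪ links B := by
  cases B with
  | nil => simp at h
  | cons f F =>
    obtain rfl : f = y := by simpa using h
    ext p; simp [links]

/-! ### Filling the slot of a partially straightened zigzag. -/

section

variable {e : ℕ} {d : ℕ → Bool} {N : ℕ → Prop} {cn cp : ℕ → ℕ}

theorem newArc_eq_slotPoint {m : ℕ} (h : ¬ (Turns e d (m + 1) ∧ ¬ N (m + 1))) :
    newArc e d N cn cp m = orient (d m) (slotPoint e d N cn m, m + 1) := by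
  unfold newArc slotPoint
  split_ifs <;> rfl

theorem isSlotted_one (he : 1 < e) : IsSlotted e d N cn cp 1 [1] [] := by
  have h1 : ¬ Turns e d 1 := fun h => by have := h.1; omega
  refine ⟨by simp [slotPoint, h1], by simp, by intro x; simp; omega, by simp, ?_,
    by intros; omega, Or.inl ⟨rfl, by simp [links], ?_⟩⟩
  · intro s hs
    obtain rfl : 1 = s := by simpa using hs
    refine ⟨⟨⟨le_rfl, he.le, fun _ => rfl, fun h => by omega⟩, ?_⟩, fun s hs => hs.1.1⟩
    intro r hr ht
    have := ht.1
    omega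
  · intro s hs h
    have : s = 1 := le_antisymm hs h.1
    subst this
    have := h.2.2.1 he
    simp at this

/-- Old pairs keep their order. The new pair `m, m + 1` is in order because `m` lies in `F`, hence
before the slot. -/
theorem order_insert {F B : List ℕ} {m : ℕ} (h : IsSlotted e d N cn cp m F B) (i : ℕ)
    (h1 : 1 ≤ i) (hi : i < m + 1) :
    if d i = d m then [i, i + 1].Sublist (F.reverse ++ (m + 1) :: B)
      else [i + 1, i].Sublist (F.reverse ++ (m + 1) :: B) := by
  have hsub : (F.reverse ++ B).Sublist (F.reverse ++ (m + 1) :: B) :=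
    (List.Sublist.refl _).append (List.sublist_cons_self _ _)
  rcases Nat.lt_succ_iff_lt_or_eq.1 hi with hi | rfl
  · have := h.order i h1 hi
    split_ifs at this ⊢ <;> exact this.trans hsub
  · simp only [if_true]
    have : [i].Sublist F.reverse := by simpa using h.self_mem
    exact this.append (by simp : [i + 1].Sublist ((i + 1) :: B))

theorem mem_insert {F B : List ℕ} {m : ℕ} (h : IsSlotted e d N cn cp m F B) (x : ℕ) :
    x ∈ F.reverse ++ (m + 1) :: B ↔ 1 ≤ x ∧ x ≤ m + 1 := by
  have := h.mem x
  simp only [List.mem_append, List.mem_cons] at this ⊢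
  constructor
  · rintro (h | rfl | h)
    · have := this.1 (Or.inl h); omega
    · omega
    · have := this.1 (Or.inr h); omega
  · intro hx
    by_cases hm : x = m + 1
    · exact Or.inr (Or.inl hm)
    · rcases this.2 (by omega) with h | h <;> tauto

theorem nodup_insert {F B : List ℕ} {m : ℕ} (h : IsSlotted e d N cn cp m F B) :
    (F.reverse ++ (m + 1) :: B).Nodup := by
  have h1 : m + 1 ∉ F.reverse ++ B := fun hm => by have := (h.mem _).1 hm; omega
  rw [List.perm_middle.nodup_iff]
  exact List.nodup_cons.2 ⟨h1, h.nodup⟩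

/-- The pending arc is completed by the point now being inserted: directions are constant on `[t,
m]`, so `m + 1` is the first point after `t` of the opposite type. `hconf` excludes that step `t -
1` is already claimed by a negative turning point at `t - 1`. -/
theorem newArc_pred_eq
    (hcp : ∀ t, Turns e d t → ¬ N t → IsLeast {s | t < s ∧ HasType e d (!d t) s} (cp t))
    (hconf : ∀ t, Turns e d t → N t → Turns e d (t + 1) → N (t + 1)) {m t : ℕ} (htm : t ≤ m)
    (ht : Turns e d t) (hNt : ¬ N t) (hk : ∀ k, t ≤ k → k ≤ m → d k = d m)
    (hty : HasType e d (!d m) (m + 1)) :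
    newArc e d N cn cp (t - 1) = orient (d m) (m + 1, t - 1) := by
  have hcpt : cp t = m + 1 := by
    refine (hcp t ht hNt).unique ⟨⟨by omega, by rw [hk t le_rfl htm]; exact hty⟩, ?_⟩
    -- A candidate `s ≤ m` would have to change direction inside the constant run.
    rintro s ⟨hts, hs⟩
    by_contra hlt
    have h1 := hs.2.2.2 (by have := ht.1; omega)
    rw [Bool.not_not, hk t le_rfl htm, hk (s - 1) (by omega) (by omega)] at h1
    have h2 := hs.2.2.1 (by have := hty.2.1; omega)
    rw [hk s (by omega) (by omega), hk t le_rfl htm] at h2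
    simp at h2
  have ht1 : t - 1 + 1 = t := by have := ht.1; omega
  unfold newArc
  rw [if_neg, if_pos, ht1, hcpt]
  · have : d (t - 1) = !d m := by
      have := ht.2.2
      rw [hk t le_rfl htm] at this
      revert this; cases d (t - 1) <;> cases d m <;> simp
    rw [this, orient_not_mk]
  · rw [ht1]; exact ⟨ht, hNt⟩
  · rintro ⟨h1, h2⟩
    have := hconf _ h1 h2
    rw [ht1] at this
    exact hNt (this ht)

/-- Closing the gap of a partially straightened zigzag at a point of the opposite type. -/
theorem links_insert
    (hcp : ∀ t, Turns e d t → ¬ N t → IsLeast {s | t < s ∧ HasType e d (!d t) s} (cp t))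
    (hconf : ∀ t, Turns e d t → N t → Turns e d (t + 1) → N (t + 1))
    {F B : List ℕ} {m : ℕ} (h : IsSlotted e d N cn cp m F B)
    (hty : HasType e d (!d m) (m + 1)) (hneg : ¬ (Turns e d (m + 1) ∧ ¬ N (m + 1))) :
    links (F.reverse ++ (m + 1) :: B) =
      orient (d m) '' (newArc e d N cn cp '' Set.Ico 1 (m + 1)) := by
  have hm : 1 ≤ m := by
    have := (h.mem m).1 (by simp [h.self_mem]); exact this.1
  have hIco : Set.Ico 1 (m + 1) = insert m (Set.Ico 1 m) := by
    ext x; simp only [Set.mem_Ico, Set.mem_insert_iff]; omega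
  rw [links_reverse_append_cons h.head]
  rcases h.links_eq with ⟨rfl, hl, -⟩ | ⟨t, htm, ht, hNt, hk, hB, -, hl⟩
  · rw [hl, hIco, Set.image_insert_eq, Set.image_insert_eq, newArc_eq_slotPoint hneg,
      orient_orient]
    ext p; simp [links]
  · have harc := newArc_pred_eq (cn := cn) hcp hconf htm ht hNt hk hty
    have hset : Set.Ico 1 m = insert (t - 1) (Set.Ico 1 m \ {t - 1}) := by
      -- Inserting `m + 1` creates two links across the slot: one is the arc `m`, the other is the
      -- arc `t - 1` that was missing.
      rw [Set.insert_sdiff_singleton, Set.insert_eq_of_mem]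
      have := ht.1
      simp only [Set.mem_Ico]; omega
    rw [links_cons_of_head? hB, hIco, hset, Set.image_insert_eq, Set.image_insert_eq,
      Set.image_insert_eq, Set.image_insert_eq, ← hl, newArc_eq_slotPoint hneg, harc,
      orient_orient, orient_orient]
    ext p
    simp only [Set.mem_union, Set.mem_singleton_iff, Set.mem_insert_iff]
    tauto

end

/-! ### Preservation of the invariant: straight steps, negative and positive turns. -/

section

variable {e : ℕ} {d : ℕ → Bool} {N : ℕ → Prop} {cn cp : ℕ → ℕ}

theorem orient_true_image (X : Set (ℕ × ℕ)) : orient true '' X = X :=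
  Set.image_id X

/-- Only a negative turning point of the type opposite to `b` can displace the first point beyond;
`hm` says that `m + 1` is not one. -/
theorem isFirstBeyond_succ {m s : ℕ} {b : Bool}
    (hm : Turns e d (m + 1) → N (m + 1) → d (m + 1) = b)
    (h : IsFirstBeyond e d N m b s) : IsFirstBeyond e d N (m + 1) b s := by
  have : {s | HasType e d b s ∧ ∀ r ≤ m + 1, Turns e d r → N r → d r = !b → r < s} =
      {s | HasType e d b s ∧ ∀ r ≤ m, Turns e d r → N r → d r = !b → r < s} := by
    ext s
    refine and_congr_right fun _ => ⟨fun h r hr => h r (by omega), fun h r hr ht hN hd => ?_⟩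
    rcases Nat.le_succ_iff.1 hr with hr | rfl
    · exact h r hr ht hN hd
    · rw [hm ht hN] at hd; simp at hd
  unfold IsFirstBeyond
  rw [this]
  exact h

theorem isSlotted_succ_of_eq {F B : List ℕ} {m : ℕ} (h : IsSlotted e d N cn cp m F B)
    (hme : m + 1 < e) (hd : d (m + 1) = d m) : IsSlotted e d N cn cp (m + 1) ((m + 1) :: F) B := by
  have hm : 1 ≤ m := by
    have := (h.mem m).1 (by simp [h.self_mem]); exact this.1
  have hT : ¬ Turns e d (m + 1) := fun ht => ht.2.2 (by simpa using hd.symm)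
  have hIco : Set.Ico 1 (m + 1) = insert m (Set.Ico 1 m) := by
    ext x; simp only [Set.mem_Ico, Set.mem_insert_iff]; omega
  have hK : ((m + 1) :: F).reverse ++ B = F.reverse ++ (m + 1) :: B := by simp
  have hFne : F ≠ [] := by rintro rfl; simpa using h.head
  have harc := newArc_eq_slotPoint (cn := cn) (cp := cp) (N := N) fun ht => hT ht.1
  have hlF : links ((m + 1) :: F).reverse =
      links F.reverse ∪ {(slotPoint e d N cn m, m + 1)} := by
    rw [List.reverse_cons, links_reverse_append_cons h.head]
    simp [links]
  refine ⟨by simp [slotPoint, hT], ?_, ?_, by simp, ?_, ?_, ?_⟩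
  · rw [hK]; exact nodup_insert h
  · rw [hK]; exact mem_insert h
  · intro s hs
    rw [List.getLast?_cons_of_ne_nil hFne] at hs
    rw [hd]
    exact isFirstBeyond_succ (fun ht => absurd ht hT) (h.last s hs)
  · rw [hK, hd]
    exact order_insert h
  · rcases h.links_eq with ⟨rfl, hl, hs⟩ | ⟨t, htm, ht, hNt, hk, hB, hlast, hl⟩
    · refine Or.inl ⟨rfl, ?_, ?_⟩
      · rw [hlF, hl, hIco, hd, Set.image_insert_eq, Set.image_insert_eq, harc, orient_orient]
        ext p; simp
      · intro s hsm hty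
        rw [hd] at hty ⊢
        rcases Nat.le_succ_iff.1 hsm with hsm | rfl
        · obtain ⟨r, hr, h⟩ := hs s hsm hty
          exact ⟨r, by omega, h⟩
        · have := hty.2.2.1 hme
          rw [Nat.succ_eq_add_one, hd] at this
          simp at this
    · refine Or.inr ⟨t, by omega, ht, hNt, ?_, hB, ?_, ?_⟩
      · intro k h1 h2
        rw [hd]
        rcases Nat.le_succ_iff.1 h2 with h2 | rfl
        · exact hk k h1 h2
        · exact hd
      · intro s hs
        rw [hd]
        exact isFirstBeyond_succ (fun ht => absurd ht hT) (hlast s hs)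
      · have hset : Set.Ico 1 (m + 1) \ {t - 1} = insert m (Set.Ico 1 m \ {t - 1}) := by
          have := ht.1
          ext x; simp only [Set.mem_Ico, Set.mem_insert_iff, Set.mem_sdiff, Set.mem_singleton_iff]
          omega
        rw [hlF, hset, hd, Set.image_insert_eq, Set.image_insert_eq, harc, orient_orient, ← hl]
        ext p; simp only [Set.mem_union, Set.mem_singleton_iff, Set.mem_insert_iff]
        tauto

theorem hasType_of_turns {t : ℕ} (h : Turns e d t) : HasType e d (d t) t := by
  refine ⟨h.1.le, h.2.1.le, fun _ => rfl, fun _ => ?_⟩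
  have := h.2.2
  revert this; cases d (t - 1) <;> cases d t <;> simp

/-- This serves the case `B = []`: every earlier candidate has been passed by a negative turning
point, so the new turning point becomes the extremity of the list. -/
theorem isFirstBeyond_of_forall_exists {m : ℕ} (hT : Turns e d (m + 1)) (hd : d (m + 1) = !d m)
    (h : ∀ s ≤ m, HasType e d (!d m) s → ∃ r ≤ m, Turns e d r ∧ N r ∧ d r = d m ∧ s < r) :
    IsFirstBeyond e d N (m + 1) (d (m + 1)) (m + 1) := by
  refine ⟨⟨hasType_of_turns hT, ?_⟩, ?_⟩
  · intro r hr _ _ hr2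
    rcases Nat.le_succ_iff.1 hr with hr | rfl
    · omega
    · simp at hr2
  · rintro s ⟨hs1, hs2⟩
    by_contra hlt
    rw [hd] at hs1 hs2
    obtain ⟨r, hr1, hr2, hr3, hr4, hr5⟩ := h s (by omega) hs1
    have := hs2 r (by omega) hr2 hr3 (by simpa using hr4)
    omega

theorem order_reverse {L : List ℕ} {x y : Bool} {i : ℕ}
    (h : if x = y then [i, i + 1].Sublist L else [i + 1, i].Sublist L) :
    if x = !y then [i, i + 1].Sublist L.reverse else [i + 1, i].Sublist L.reverse := by
  by_cases hxy : x = y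
  · rw [if_pos hxy] at h
    rw [if_neg (by rw [hxy]; simp)]
    simpa using h.reverse
  · rw [if_neg hxy] at h
    rw [if_pos (by revert hxy; cases x <;> cases y <;> simp)]
    simpa using h.reverse

/-- The slot is filled, which settles any pending arc, and the list is reversed with nothing after
the new slot. The next point will be linked to the old first entry, which the invariant `last`
identifies with the crossed point. -/
theorem isSlotted_succ_of_neg
    (hcn : ∀ t, Turns e d t → N t →
      IsLeast {s | HasType e d (!d t) s ∧ ∀ r < t, Turns e d r → N r → d r = d t → r < s} (cn t))
    (hcp : ∀ t, Turns e d t → ¬ N t → IsLeast {s | t < s ∧ HasType e d (!d t) s} (cp t))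
    (hconf : ∀ t, Turns e d t → N t → Turns e d (t + 1) → N (t + 1))
    {F B : List ℕ} {m : ℕ} (h : IsSlotted e d N cn cp m F B)
    (hT : Turns e d (m + 1)) (hN : N (m + 1)) :
    IsSlotted e d N cn cp (m + 1) (F.reverse ++ (m + 1) :: B) [] := by
  have hm : 1 ≤ m := by
    have := (h.mem m).1 (by simp [h.self_mem]); exact this.1
  have hd : d (m + 1) = !d m := by
    have := hT.2.2
    rw [Nat.add_sub_cancel] at this
    revert this; cases d m <;> cases d (m + 1) <;> simp
  have hFne : F ≠ [] := by rintro rfl; simpa using h.head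
  obtain ⟨c, hc⟩ := Option.ne_none_iff_exists'.1 (mt List.getLast?_eq_none_iff.1 hFne)
  have hcm : cn (m + 1) = c := by
    -- Since `d (m + 1) = !d m`, the condition defining `cn (m + 1)` is the one defining the first
    -- point beyond of type `d m` up to `m`.
    refine (hcn _ hT hN).unique ?_
    have := h.last c hc
    unfold IsFirstBeyond at this
    rw [hd, Bool.not_not]
    simpa only [Nat.lt_succ_iff, hd] using this
  have hty := hasType_of_turns hT
  rw [hd] at hty
  have hlinks := links_insert hcp hconf h hty (fun h => h.2 hN)
  refine ⟨?_, ?_, ?_, by simp, ?_, ?_, Or.inl ⟨rfl, ?_, ?_⟩⟩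
  · simp only [slotPoint, hT, hN, and_self, if_true, hcm]
    rw [List.head?_append_of_ne_nil _ (by simpa using hFne), List.head?_reverse, hc]
  · rw [List.append_nil, List.nodup_reverse]; exact nodup_insert h
  · intro x
    rw [List.append_nil, List.mem_reverse]; exact mem_insert h x
  · intro s hs
    have hs' : ((m + 1) :: B).getLast? = some s := by
      rwa [List.getLast?_append_of_ne_nil _ (by simp)] at hs
    rcases h.links_eq with ⟨rfl, hl, hsm⟩ | ⟨t, htm, ht, hNt, hk, hB, hlast, hl⟩
    · obtain rfl : m + 1 = s := by simpa using hs'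
      exact isFirstBeyond_of_forall_exists hT hd hsm
    · have hBne : B ≠ [] := by rintro rfl; simp at hB
      rw [List.getLast?_cons_of_ne_nil hBne] at hs'
      exact isFirstBeyond_succ (fun _ _ => rfl) (by rw [hd]; exact hlast s hs')
  · intro i h1 hi
    have := order_insert h i h1 hi
    rw [List.append_nil, hd]
    exact order_reverse this
  · rw [links_reverse, hlinks, swap_image_orient_image, hd]
  · intro s hs hty
    -- The new negative turning point itself passes all earlier points of the opposite type.
    refine ⟨m + 1, le_rfl, hT, hN, rfl, ?_⟩
    rcases Nat.le_succ_iff.1 hs with hs | rfl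
    · omega
    · have := hty.2.2.1 hT.2.1
      simp at this

/-- After reversal the slot separates `m + 1` from `m`, so the two halves exchange roles. A
previously pending arc is settled by `m + 1`, and the arc `m` becomes the pending one. -/
theorem isSlotted_succ_of_pos
    (hcp : ∀ t, Turns e d t → ¬ N t → IsLeast {s | t < s ∧ HasType e d (!d t) s} (cp t))
    (hconf : ∀ t, Turns e d t → N t → Turns e d (t + 1) → N (t + 1))
    {F B : List ℕ} {m : ℕ} (h : IsSlotted e d N cn cp m F B)
    (hT : Turns e d (m + 1)) (hN : ¬ N (m + 1)) :
    IsSlotted e d N cn cp (m + 1) ((m + 1) :: B) F := by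
  have hm : 1 ≤ m := by
    have := (h.mem m).1 (by simp [h.self_mem]); exact this.1
  have hd : d (m + 1) = !d m := by
    have := hT.2.2
    rw [Nat.add_sub_cancel] at this
    revert this; cases d m <;> cases d (m + 1) <;> simp
  have hFne : F ≠ [] := by rintro rfl; simpa using h.head
  -- By `hconf`, `m` is not a negative turning point, so its arc really starts at `m`.
  have hslot : slotPoint e d N cn m = m :=
    if_neg fun hc => hN (hconf m hc.1 hc.2 hT)
  have hK : ((m + 1) :: B).reverse ++ F = (F.reverse ++ (m + 1) :: B).reverse := by simp
  refine ⟨by simp [slotPoint, hN], ?_, ?_, by simp, ?_, ?_, Or.inr ⟨m + 1, le_rfl, hT, hN,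
    fun k h1 h2 => by rw [le_antisymm h2 h1], by rw [h.head, hslot, Nat.add_sub_cancel], ?_, ?_⟩⟩
  · rw [hK, List.nodup_reverse]; exact nodup_insert h
  · intro x
    rw [hK, List.mem_reverse]; exact mem_insert h x
  · intro s hs
    rcases h.links_eq with ⟨rfl, hl, hsm⟩ | ⟨t, htm, ht, hNt, hk, hB, hlast, hl⟩
    · obtain rfl : m + 1 = s := by simpa using hs
      exact isFirstBeyond_of_forall_exists hT hd hsm
    · have hBne : B ≠ [] := by rintro rfl; simp at hB
      rw [List.getLast?_cons_of_ne_nil hBne] at hs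
      exact isFirstBeyond_succ (fun _ _ => rfl) (by rw [hd]; exact hlast s hs)
  · intro i h1 hi
    have := order_insert h i h1 hi
    rw [hK, hd]
    exact order_reverse this
  · intro s hs
    rw [hd, Bool.not_not]
    exact isFirstBeyond_succ (fun _ h => absurd h hN) (h.last s hs)
  · have hset : Set.Ico 1 (m + 1) \ {m + 1 - 1} = Set.Ico 1 m := by
      ext x; simp only [Set.mem_Ico, Set.mem_sdiff, Set.mem_singleton_iff]
      omega
    rw [hset, hd, ← swap_image_orient_image, links_reverse]
    rcases h.links_eq with ⟨rfl, hl, -⟩ | ⟨t, htm, ht, hNt, hk, hB, -, hl⟩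
    · rw [← hl, links_reverse, Set.image_image]
      simp [links]
    · rw [links_cons_of_head? hB]
      have ht1 : t - 1 + 1 = t := by have := ht.1; omega
      have hset : Set.Ico 1 m = insert (t - 1) (Set.Ico 1 m \ {t - 1}) := by
        rw [Set.insert_sdiff_singleton, Set.insert_eq_of_mem]
        have := ht.1
        simp only [Set.mem_Ico]; omega
      have hty := hasType_of_turns hT
      rw [hd] at hty
      rw [hset, Set.image_insert_eq, Set.image_insert_eq, ← hl,
        newArc_pred_eq hcp hconf htm ht hNt hk hty, orient_orient, Set.image_insert_eq,
        Set.image_union, Set.image_union, links_reverse, Set.image_image]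
      ext p
      simp only [Set.mem_union, Set.mem_insert_iff, Set.image_singleton, Set.mem_singleton_iff,
        Prod.swap_swap, Set.image_id']
      tauto

theorem exists_isSlotted
    (hcn : ∀ t, Turns e d t → N t →
      IsLeast {s | HasType e d (!d t) s ∧ ∀ r < t, Turns e d r → N r → d r = d t → r < s} (cn t))
    (hcp : ∀ t, Turns e d t → ¬ N t → IsLeast {s | t < s ∧ HasType e d (!d t) s} (cp t))
    (hconf : ∀ t, Turns e d t → N t → Turns e d (t + 1) → N (t + 1))
    (m : ℕ) (hm : 1 ≤ m) (hme : m < e) : ∃ F B, IsSlotted e d N cn cp m F B := by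
  induction m, hm using Nat.le_induction with
  | base => exact ⟨_, _, isSlotted_one hme⟩
  | succ m hm ih =>
    obtain ⟨F, B, h⟩ := ih (by omega)
    by_cases hd : d (m + 1) = d m
    · exact ⟨_, _, isSlotted_succ_of_eq h hme hd⟩
    · have hT : Turns e d (m + 1) := ⟨by omega, hme, by simpa using Ne.symm hd⟩
      by_cases hN : N (m + 1)
      · exact ⟨_, _, isSlotted_succ_of_neg hcn hcp hconf h hT hN⟩
      · exact ⟨_, _, isSlotted_succ_of_pos hcp hconf h hT hN⟩

/-- The new arcs of a straightened zigzag form a directed path through all points, along which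
the old arcs point forwards. -/
theorem exists_list_links_eq (he : 1 < e)
    (hcn : ∀ t, Turns e d t → N t →
      IsLeast {s | HasType e d (!d t) s ∧ ∀ r < t, Turns e d r → N r → d r = d t → r < s} (cn t))
    (hcp : ∀ t, Turns e d t → ¬ N t → IsLeast {s | t < s ∧ HasType e d (!d t) s} (cp t))
    (hconf : ∀ t, Turns e d t → N t → Turns e d (t + 1) → N (t + 1)) :
    ∃ L : List ℕ, L.Nodup ∧ (∀ x, x ∈ L ↔ 1 ≤ x ∧ x ≤ e) ∧
      links L = newArc e d N cn cp '' Set.Ico 1 e ∧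
      ∀ i, 1 ≤ i → i < e → if d i then [i, i + 1].Sublist L else [i + 1, i].Sublist L := by
  obtain ⟨m, rfl⟩ : ∃ m, e = m + 1 := ⟨e - 1, by omega⟩
  obtain ⟨F, B, h⟩ := exists_isSlotted hcn hcp hconf m (by omega) (by omega)
  -- The end-point always has the type opposite to that of the last step, so it closes any pending
  -- arc.
  have hty : HasType (m + 1) d (!d m) (m + 1) :=
    ⟨by omega, le_rfl, fun h => by omega, fun _ => by simp⟩
  have hlinks := links_insert hcp hconf h hty (fun h => by have := h.1.2.1; omega)
  cases hdm : d m
  · refine ⟨(F.reverse ++ (m + 1) :: B).reverse, List.nodup_reverse.2 (nodup_insert h), ?_, ?_, ?_⟩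
    · intro x; rw [List.mem_reverse]; exact mem_insert h x
    · rw [links_reverse, hlinks, swap_image_orient_image, hdm]
      exact orient_true_image _
    · intro i h1 hi
      have := order_insert h i h1 hi
      rw [hdm] at this
      cases hdi : d i
      · rw [if_pos hdi] at this
        simpa using this.reverse
      · rw [if_neg (by rw [hdi]; simp)] at this
        simpa using this.reverse
  · refine ⟨F.reverse ++ (m + 1) :: B, nodup_insert h, mem_insert h, ?_, ?_⟩
    · rw [hlinks, hdm]
      exact orient_true_image _
    · intro i h1 hi
      have := order_insert h i h1 hi
      rwa [hdm] at this

end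

/-! ### Simple systems of type `A` -/

theorem root_apply (r s i : ℕ) :
    root r s i = (if i = r then 1 else 0) - (if i = s then 1 else 0) := by
  simp [root, Pi.single_apply]

theorem neg_root (r s : ℕ) : -root r s = root s r := by simp [root]

theorem root_add_root (r s t : ℕ) : root r s + root s t = root r t := by simp [root]

/-- The differences of consecutive entries of a list. -/
def linkRoots (L : List ℕ) : Set (ℕ → ℤ) := (fun p => root p.1 p.2) '' links L

theorem linkRoots_cons_cons (x y : ℕ) (L : List ℕ) :
    linkRoots (x :: y :: L) = insert (root x y) (linkRoots (y :: L)) := by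
  simp [linkRoots, links, Set.image_insert_eq]

theorem natSpan_mono {X Y : Set (ℕ → ℤ)} (h : X ⊆ Y) : natSpan X ⊆ natSpan Y :=
  AddSubmonoid.closure_mono h

theorem linkRoots_subset_cons (x : ℕ) (L : List ℕ) : linkRoots L ⊆ linkRoots (x :: L) := by
  cases L with
  | nil => simp [linkRoots, links]
  | cons y L => rw [linkRoots_cons_cons]; exact Set.subset_insert _ _

theorem root_head_mem_natSpan (L : List ℕ) (x y : ℕ) (hy : y ∈ L) :
    root x y ∈ natSpan (linkRoots (x :: L)) := by
  induction L generalizing x with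
  | nil => simp at hy
  | cons z L ih =>
    have hz : root x z ∈ natSpan (linkRoots (x :: z :: L)) :=
      AddSubmonoid.subset_closure (by rw [linkRoots_cons_cons]; exact Set.mem_insert _ _)
    rcases List.mem_cons.1 hy with rfl | hy
    · exact hz
    · rw [← root_add_root x z y]
      exact AddSubmonoid.add_mem _ hz (natSpan_mono (linkRoots_subset_cons _ _) (ih z hy))

theorem root_mem_natSpan_of_sublist {L : List ℕ} {x y : ℕ} (h : [x, y].Sublist L) :
    root x y ∈ natSpan (linkRoots L) := by
  induction L with
  | nil => simp at h
  | cons z L ih =>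
    rcases List.sublist_cons_iff.1 h with h | ⟨r, hr, h⟩
    · exact natSpan_mono (linkRoots_subset_cons _ _) (ih h)
    · simp only [List.cons.injEq] at hr
      obtain ⟨rfl, rfl⟩ := hr
      exact root_head_mem_natSpan L x y (by simpa using h)

theorem pair_sublist_or {L : List ℕ} {x y : ℕ} (hx : x ∈ L) (hy : y ∈ L) (hxy : x ≠ y) :
    [x, y].Sublist L ∨ [y, x].Sublist L := by
  induction L with
  | nil => simp at hx
  | cons z L ih =>
    rcases List.mem_cons.1 hx with rfl | hx'
    · rcases List.mem_cons.1 hy with rfl | hy'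
      · exact absurd rfl hxy
      · exact Or.inl (by simpa using hy')
    · rcases List.mem_cons.1 hy with rfl | hy'
      · exact Or.inr (by simpa using hx')
      · exact (ih hx' hy').imp (·.cons z) (·.cons z)

theorem linkRoots_eq_range (L : List ℕ) :
    linkRoots L = Set.range fun k : Fin (L.length - 1) =>
      root (L.getD k 0) (L.getD (k + 1) 0) := by
  induction L with
  | nil => ext x; simp [linkRoots, links]
  | cons x L ih =>
    cases L with
    | nil => ext x; simp [linkRoots, links]
    | cons y L =>
      rw [linkRoots_cons_cons, ih]
      ext γ
      simp only [Set.mem_insert_iff, Set.mem_range]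
      constructor
      · rintro (rfl | ⟨k, rfl⟩)
        · exact ⟨⟨0, by simp⟩, by simp⟩
        · refine ⟨⟨k + 1, ?_⟩, by simp⟩
          have := k.2
          simp only [List.length_cons] at this ⊢
          omega
      · rintro ⟨⟨k, hk⟩, rfl⟩
        cases k with
        | zero => exact Or.inl (by simp)
        | succ k =>
          refine Or.inr ⟨⟨k, ?_⟩, by simp⟩
          simp only [List.length_cons] at hk ⊢
          omega

theorem getD_eq_getD_iff {L : List ℕ} (hL : L.Nodup) {i j : ℕ} (hi : i < L.length)
    (hj : j < L.length) : L.getD i 0 = L.getD j 0 ↔ i = j := by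
  rw [List.getD_eq_getElem _ _ hi, List.getD_eq_getElem _ _ hj]
  exact hL.getElem_inj_iff

theorem linearIndependent_linkRoots {L : List ℕ} (hL : L.Nodup) :
    LinearIndependent ℤ fun k : Fin (L.length - 1) =>
      root (L.getD k 0) (L.getD (k + 1) 0) := by
  rw [Fintype.linearIndependent_iff]
  intro g hg j
  have hj := j.2
  -- Summing the coordinates at the first `j + 1` entries kills every link except the one leaving
  -- this initial segment, namely the `j`-th; what remains is `g j`.
  have h : ∑ i ∈ Finset.range (j + 1),
      (∑ k, g k • root (L.getD k 0) (L.getD (k + 1) 0)) (L.getD i 0) = 0 := by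
    rw [hg]; simp
  simp only [Finset.sum_apply, Pi.smul_apply, smul_eq_mul] at h
  rw [Finset.sum_comm] at h
  simp only [← Finset.mul_sum] at h
  have hk : ∀ k : Fin (L.length - 1), ∑ i ∈ Finset.range (j + 1),
      root (L.getD k 0) (L.getD (k + 1) 0) (L.getD i 0) = if k = j then 1 else 0 := by
    intro k
    have hk := k.2
    have : ∀ i ∈ Finset.range (j + 1), root (L.getD k 0) (L.getD (k + 1) 0) (L.getD i 0) =
        (if i = (k : ℕ) then 1 else 0) - (if i = k + 1 then 1 else 0) := by
      intro i hi
      rw [Finset.mem_range] at hi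
      rw [root_apply]
      simp only [getD_eq_getD_iff hL (show i < L.length by omega)
        (show (k : ℕ) < L.length by omega), getD_eq_getD_iff hL (show i < L.length by omega)
        (show (k : ℕ) + 1 < L.length by omega)]
    rw [Finset.sum_congr rfl this, Finset.sum_sub_distrib, Finset.sum_ite_eq', Finset.sum_ite_eq']
    simp only [Finset.mem_range, Fin.ext_iff]
    split_ifs <;> omega
  simpa only [hk, mul_ite, mul_one, mul_zero, Finset.sum_ite_eq', Finset.mem_univ, if_true] using h

theorem isSimpleSystem_linkRoots {L : List ℕ} (hL : L.Nodup) :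
    IsSimpleSystem (rootsOn {x | x ∈ L}) (linkRoots L) where
  subset := by
    rw [linkRoots_eq_range]
    rintro _ ⟨k, rfl⟩
    have hk := k.2
    have h1 : (k : ℕ) < L.length := by omega
    have h2 : (k : ℕ) + 1 < L.length := by omega
    refine ⟨_, ?_, _, ?_, ?_, rfl⟩
    · rw [List.getD_eq_getElem _ _ h1]; exact List.getElem_mem h1
    · rw [List.getD_eq_getElem _ _ h2]; exact List.getElem_mem h2
    · rw [Ne, getD_eq_getD_iff hL h1 h2]; omega
  linearIndependent := by
    rw [linkRoots_eq_range]
    exact (linearIndependent_linkRoots hL).linearIndepOn_id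
  pos_or_neg := by
    rintro _ ⟨x, hx, y, hy, hxy, rfl⟩
    rw [neg_root]
    exact (pair_sublist_or hx hy hxy).imp root_mem_natSpan_of_sublist root_mem_natSpan_of_sublist

theorem scalar_root {n r s : ℕ} (hr : r ∈ Finset.Icc 1 n) (hs : s ∈ Finset.Icc 1 n) (x y : ℕ) :
    scalar n (root r s) (root x y) = (if r = x then 1 else 0) - (if r = y then 1 else 0) -
      (if s = x then 1 else 0) + (if s = y then 1 else 0) := by
  unfold scalar
  simp only [root_apply, sub_mul, Finset.sum_sub_distrib, ite_mul, one_mul, zero_mul,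
    Finset.sum_ite_eq', hr, hs, if_true]
  ring

theorem isOfTypeA_linkRoots {n : ℕ} {L : List ℕ} (hL : L.Nodup)
    (hn : ∀ x ∈ L, x ∈ Finset.Icc 1 n) : IsOfTypeA n (L.length - 1) (linkRoots L) := by
  have hinj := (linearIndependent_linkRoots hL).injective
  refine ⟨(Equiv.ofInjective _ hinj).trans (Equiv.setCongr (linkRoots_eq_range L).symm), ?_⟩
  intro j k
  have hj := j.2
  have hk := k.2
  have hmem : ∀ i, i < L.length → L.getD i 0 ∈ Finset.Icc 1 n := fun i hi => hn _ (by
    rw [List.getD_eq_getElem _ _ hi]; exact List.getElem_mem hi)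
  have h : scalar n (root (L.getD j 0) (L.getD (j + 1) 0)) (root (L.getD k 0) (L.getD (k + 1) 0)) =
      CartanMatrix.A (L.length - 1) j k := by
    rw [scalar_root (hmem _ (by omega)) (hmem _ (by omega))]
    simp only [getD_eq_getD_iff hL (show (j : ℕ) < L.length by omega)
        (show (k : ℕ) < L.length by omega), getD_eq_getD_iff hL (show (j : ℕ) < L.length by omega)
        (show (k : ℕ) + 1 < L.length by omega),
        getD_eq_getD_iff hL (show (j : ℕ) + 1 < L.length by omega)
        (show (k : ℕ) < L.length by omega),
        getD_eq_getD_iff hL (show (j : ℕ) + 1 < L.length by omega)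
        (show (k : ℕ) + 1 < L.length by omega)]
    simp only [CartanMatrix.A, Matrix.of_apply, Fin.ext_iff]
    split_ifs <;> omega
  exact h

/-! ### Parts and nil roots -/

/-- `x` and `y` lie in the same part, an interval. -/
def SamePart {n : ℕ} (P : Finpartition (Finset.Icc 1 n)) (x y : ℕ) : Prop :=
  ∃ p q, Finset.Icc p q ∈ P.parts ∧ (p ≤ x ∧ x ≤ q) ∧ p ≤ y ∧ y ≤ q

/-- `x < y` or `y < x` according to the direction of arrows on the side `b`. -/
def Before (b : Bool) (x y : ℕ) : Prop := if b then x < y else y < x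

section

variable {n : ℕ} {P : Finpartition (Finset.Icc 1 n)}

theorem part_unique {p q p' q' x : ℕ} (h : Finset.Icc p q ∈ P.parts)
    (h' : Finset.Icc p' q' ∈ P.parts) (hx : p ≤ x ∧ x ≤ q) (hx' : p' ≤ x ∧ x ≤ q') :
    p = p' ∧ q = q' := by
  have heq := P.eq_of_mem_parts h h' (Finset.mem_Icc.2 hx) (Finset.mem_Icc.2 hx')
  have h1 : p ∈ Finset.Icc p' q' := heq ▸ Finset.mem_Icc.2 ⟨le_rfl, hx.1.trans hx.2⟩
  have h2 : q ∈ Finset.Icc p' q' := heq ▸ Finset.mem_Icc.2 ⟨hx.1.trans hx.2, le_rfl⟩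
  have h3 : p' ∈ Finset.Icc p q := heq ▸ Finset.mem_Icc.2 ⟨le_rfl, hx'.1.trans hx'.2⟩
  have h4 : q' ∈ Finset.Icc p q := heq ▸ Finset.mem_Icc.2 ⟨hx'.1.trans hx'.2, le_rfl⟩
  rw [Finset.mem_Icc] at h1 h2 h3 h4
  omega

theorem exists_part (hP : IsConnectedPartition P) {x : ℕ} (hx : x ∈ Finset.Icc 1 n) :
    ∃ p q, Finset.Icc p q ∈ P.parts ∧ p ≤ x ∧ x ≤ q := by
  obtain ⟨B, hB, hxB⟩ := P.exists_mem hx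
  obtain ⟨p, q, rfl⟩ := hP B hB
  exact ⟨p, q, hB, Finset.mem_Icc.1 hxB⟩

theorem part_subset {p q x : ℕ} (h : Finset.Icc p q ∈ P.parts) (hx : p ≤ x ∧ x ≤ q) :
    1 ≤ x ∧ x ≤ n :=
  Finset.mem_Icc.1 (P.le h (Finset.mem_Icc.2 hx))

theorem SamePart.symm {x y : ℕ} (h : SamePart P x y) : SamePart P y x := by
  obtain ⟨p, q, h, hx, hy⟩ := h
  exact ⟨p, q, h, hy, hx⟩

theorem SamePart.trans {x y z : ℕ} (h : SamePart P x y) (h' : SamePart P y z) :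
    SamePart P x z := by
  obtain ⟨p, q, h, hx, hy⟩ := h
  obtain ⟨p', q', h', hx', hy'⟩ := h'
  obtain ⟨rfl, rfl⟩ := part_unique h h' hy hx'
  exact ⟨p, q, h, hx, hy'⟩

theorem SamePart.of_between {x y z : ℕ} {c : Bool} (h : SamePart P x z) (hxy : Before c x y)
    (hyz : Before c y z) : SamePart P x y := by
  obtain ⟨p, q, h, hx, hy⟩ := h
  refine ⟨p, q, h, hx, ?_⟩
  cases c <;> simp only [Before] at hxy hyz <;> simp at hxy hyz <;> omega

theorem sum_range_root (k x y : ℕ) : ∑ i ∈ Finset.range (k + 1), root x y i =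
    (if x ≤ k then 1 else 0) - (if y ≤ k then 1 else 0) := by
  simp [root_apply, Finset.sum_sub_distrib]

/-- The partial sum of coordinates up to `k` reads off the coefficient of `simpleRoot k`. -/
theorem sum_range_of_mem_natSpan {I : Set ℕ} {γ : ℕ → ℤ} (h : γ ∈ natSpan (simpleRoot '' I))
    (k : ℕ) : 0 ≤ ∑ i ∈ Finset.range (k + 1), γ i ∧
      (k ∉ I → ∑ i ∈ Finset.range (k + 1), γ i = 0) := by
  induction h using AddSubmonoid.closure_induction with
  | mem γ h =>
    obtain ⟨i, hi, rfl⟩ := h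
    rw [simpleRoot, sum_range_root]
    refine ⟨by split_ifs <;> omega, fun hk => ?_⟩
    have : k ≠ i := fun h => hk (h ▸ hi)
    split_ifs <;> omega
  | zero => simp
  | add x y _ _ hx hy =>
    simp only [Pi.add_apply, Finset.sum_add_distrib]
    refine ⟨by omega, fun hk => ?_⟩
    rw [hx.2 hk, hy.2 hk, add_zero]

theorem samePart_of_simpleIndices (hP : IsConnectedPartition P) {k : ℕ}
    (hk : k ∈ simpleIndices P) : SamePart P k (k + 1) := by
  obtain ⟨B, hB, h1, h2⟩ := hk
  obtain ⟨p, q, rfl⟩ := hP B hB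
  exact ⟨p, q, hB, Finset.mem_Icc.1 h1, Finset.mem_Icc.1 h2⟩

theorem root_mem_natSpan_iff (hP : IsConnectedPartition P) {x y : ℕ} (hxy : x ≠ y) :
    root x y ∈ natSpan (simpleRoot '' simpleIndices P) ↔ x < y ∧ SamePart P x y := by
  constructor
  · intro h
    have hlt : x < y := by
      have := (sum_range_of_mem_natSpan h y).1
      rw [sum_range_root] at this
      split_ifs at this <;> omega
    -- The partial sum at such a `k` equals `1`, so `simpleRoot k` must occur.
    have hk : ∀ k, x ≤ k → k < y → SamePart P k (k + 1) := by
      intro k h1 h2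
      apply samePart_of_simpleIndices hP
      by_contra hk
      have := (sum_range_of_mem_natSpan h k).2 hk
      rw [sum_range_root] at this
      split_ifs at this <;> omega
    have key : ∀ z, x + 1 ≤ z → z ≤ y → SamePart P x z := by
      intro z hz
      induction z, hz using Nat.le_induction with
      | base => exact fun h => hk x le_rfl h
      | succ z hz ih => exact fun h => (ih (by omega)).trans (hk z (by omega) (by omega))
    exact ⟨hlt, key y hlt le_rfl⟩
  · rintro ⟨hlt, p, q, h, hx, hy⟩
    have hs : ∀ k, p ≤ k → k < q → root k (k + 1) ∈ natSpan (simpleRoot '' simpleIndices P) :=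
      fun k h1 h2 => AddSubmonoid.subset_closure ⟨k, ⟨_, h, Finset.mem_Icc.2 ⟨by omega, by omega⟩,
        Finset.mem_Icc.2 ⟨by omega, by omega⟩⟩, rfl⟩
    have key : ∀ z, x + 1 ≤ z → z ≤ q → root x z ∈ natSpan (simpleRoot '' simpleIndices P) := by
      intro z hz
      induction z, hz using Nat.le_induction with
      | base => exact fun h => hs x hx.1 h
      | succ z hz ih =>
        intro h
        rw [← root_add_root x z]
        exact AddSubmonoid.add_mem _ (ih (by omega)) (hs z (by omega) (by omega))
    exact key y hlt hy.2

variable {J : Bool → Finpartition (Finset.Icc 1 n)}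

theorem root_mem_rootsK_iff (hJ : ∀ b, IsConnectedPartition (J b)) {x y : ℕ}
    (hx : x ∈ Set.Icc 1 n) (hy : y ∈ Set.Icc 1 n) (hxy : x ≠ y) :
    root x y ∈ rootsK J ↔ ∀ c, Before c x y → ¬ SamePart (J c) x y := by
  have hD : root x y ∈ Delta n := ⟨x, hx, y, hy, hxy, rfl⟩
  simp only [rootsK, rootsR, Set.mem_sdiff, Set.mem_ofPred_eq, hD, true_and, neg_root,
    root_mem_natSpan_iff (hJ _) hxy, root_mem_natSpan_iff (hJ _) hxy.symm, Bool.forall_bool, Before]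
  simp only [if_true, Bool.false_eq_true, if_false, not_or, not_and]
  have : SamePart (J false) y x ↔ SamePart (J false) x y := ⟨.symm, .symm⟩
  rw [this, and_comm]

theorem isNil_root_iff (hJ : ∀ b, IsConnectedPartition (J b)) {x y : ℕ}
    (hx : x ∈ Set.Icc 1 n) (hy : y ∈ Set.Icc 1 n) (hxy : x ≠ y) :
    IsNil J (root x y) ↔ ∃ c, ¬ SamePart (J c) x y := by
  have hs : ∀ b, SamePart (J b) y x ↔ SamePart (J b) x y := fun _ => ⟨.symm, .symm⟩
  rw [IsNil, neg_root, root_mem_rootsK_iff hJ hx hy hxy, root_mem_rootsK_iff hJ hy hx hxy.symm]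
  simp only [Bool.forall_bool, Bool.exists_bool, Before, if_true, Bool.false_eq_true, if_false, hs]
  rcases lt_or_gt_of_ne hxy with h | h <;> simp only [h, h.not_gt] <;> tauto

end

/-! ### Meanders with a fixed point -/

/-- Conjugation by `g` inverts `f * g`, so `g` sends `(f * g) ^ k` applied to a fixed point to `(f *
g) ^ (-k)` applied to it. -/
theorem zpowers_orbit_stable {f g : Equiv.Perm ℕ} (hf : f * f = 1) (hg : g * g = 1) {x y : ℕ}
    (hx : g x = x) (hy : y ∈ MulAction.orbit (Subgroup.zpowers (f * g)) x) :
    g y ∈ MulAction.orbit (Subgroup.zpowers (f * g)) x := by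
  obtain ⟨⟨_, k, rfl⟩, rfl⟩ := hy
  refine ⟨⟨(f * g) ^ (-k), -k, rfl⟩, ?_⟩
  have hgi : g⁻¹ = g := inv_eq_of_mul_eq_one_right hg
  have hfi : f⁻¹ = f := inv_eq_of_mul_eq_one_right hf
  have h1 : g * (f * g) ^ k * g⁻¹ = (f * g) ^ (-k) := by
    rw [← conj_zpow, zpow_neg, ← inv_zpow, mul_inv_rev, hgi, hfi, mul_assoc, mul_assoc, hg, mul_one]
  have h2 : g * (f * g) ^ k = (f * g) ^ (-k) * g := by
    rw [← h1]; group
  have h3 := congrArg (fun w : Equiv.Perm ℕ => w x) h2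
  simp only [Equiv.Perm.mul_apply, hx] at h3
  exact h3.symm

/-- A set stable under two involutions contains the meanders of its points. -/
theorem orbit_subset_of_stable {f g : Equiv.Perm ℕ} (hf : f * f = 1) (hg : g * g = 1) {X : Set ℕ}
    (hfX : ∀ x ∈ X, f x ∈ X) (hgX : ∀ x ∈ X, g x ∈ X) {x : ℕ} (hx : x ∈ X) :
    MulAction.orbit (Subgroup.closure {f, g}) x ⊆ X := by
  rintro _ ⟨⟨w, hw⟩, rfl⟩
  have key : ∀ z ∈ X, w z ∈ X := by
    induction hw using Subgroup.closure_induction'' with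
    | mem w hw =>
      rcases hw with rfl | rfl
      · exact hfX
      · exact hgX
    | inv_mem w hw =>
      rcases hw with rfl | rfl
      · rw [inv_eq_of_mul_eq_one_right hf]; exact hfX
      · rw [inv_eq_of_mul_eq_one_right hg]; exact hgX
    | one => simp
    | mul w w' _ _ h h' => exact fun z hz => h _ (h' z hz)
  exact key x hx

/-- The orbit of the fixed point under the product is stable under `g` and hence under `f`, so it is
the whole meander. In particular a loop has no fixed points. -/
theorem isEdge_of_fixed {f g : Equiv.Perm ℕ} (hf : f * f = 1) (hg : g * g = 1) {E : Set ℕ}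
    (hE : IsMeander f g E) {x : ℕ} (hxE : x ∈ E) (hx : g x = x) : IsEdge f g E := by
  refine ⟨hE, x, ?_⟩
  obtain ⟨y, rfl⟩ := hE
  rw [← MulAction.orbit_eq_iff.2 hxE]
  have hgs := fun z hz => zpowers_orbit_stable (y := z) hf hg hx hz
  refine Set.Subset.antisymm (orbit_subset_of_stable hf hg (fun z hz => ?_) hgs
    (MulAction.mem_orbit_self x)) ?_
  · have h1 := MulAction.mem_orbit_of_mem_orbit
      (⟨f * g, Subgroup.mem_zpowers _⟩ : Subgroup.zpowers (f * g)) (hgs z hz)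
    have h2 : (⟨f * g, Subgroup.mem_zpowers _⟩ : Subgroup.zpowers (f * g)) • g z = f z := by
      change (f * g) (g z) = f z
      rw [← Equiv.Perm.mul_apply, mul_assoc, hg, mul_one]
    rwa [h2] at h1
  · rintro _ ⟨⟨w, hw⟩, rfl⟩
    refine ⟨⟨w, ?_⟩, rfl⟩
    have hle : Subgroup.zpowers (f * g) ≤ Subgroup.closure {f, g} := by
      rw [Subgroup.zpowers_le]
      exact mul_mem (Subgroup.subset_closure (by simp)) (Subgroup.subset_closure (by simp))
    exact hle hw

/-! ### Structure of modified involutions -/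

theorem kappa_apply {p q x : ℕ} (hx : p ≤ x ∧ x ≤ q) : kappa p q x = p + q - x :=
  if_pos hx

theorem kappa_mul_self (p q : ℕ) : kappa p q * kappa p q = 1 :=
  Equiv.ext fun x => reflectFun_involutive p q x

section

variable {n : ℕ} {P : Finpartition (Finset.Icc 1 n)} {M : Set ℕ} {σ : Equiv.Perm ℕ} {p q : ℕ}

theorem mark_le (hM : ∀ i ∈ M, ∃ j, IsHalfArc P i j) (hpq : Finset.Icc p q ∈ P.parts)
    {i : ℕ} (hi : i ∈ M) (h : p ≤ i ∧ i ≤ q) : 2 * i + 1 ≤ p + q := by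
  obtain ⟨j, p', q', h', h1, h2, h3⟩ := hM i hi
  obtain ⟨rfl, rfl⟩ := part_unique hpq h' h ⟨h1, by omega⟩
  omega

theorem mem_extLeft_bounds (hM : ∀ i ∈ M, ∃ j, IsHalfArc P i j)
    (hpq : Finset.Icc p q ∈ P.parts) {u v x : ℕ} (huv : IsMarkComponent M p q u v)
    (hx : x ∈ extLeft p q u v) : p ≤ x ∧ 2 * x ≤ p + q ∧ u ≤ x ∧ x ≤ v + 1 ∧
      (x = v + 1 → 2 * v + 1 ≠ p + q) := by
  obtain ⟨h1, h2, h3, h4, -, -⟩ := huv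
  have := mark_le hM hpq (h4 v ⟨h2, le_rfl⟩) ⟨by omega, h3⟩
  rw [extLeft, Set.mem_Icc] at hx
  split_ifs at hx <;> omega

theorem mem_extRight_iff (hM : ∀ i ∈ M, ∃ j, IsHalfArc P i j)
    (hpq : Finset.Icc p q ∈ P.parts) {u v x : ℕ} (huv : IsMarkComponent M p q u v) :
    x ∈ extRight p q u v ↔ p ≤ x ∧ x ≤ q ∧ p + q - x ∈ extLeft p q u v := by
  constructor
  · rintro ⟨y, hy, rfl⟩
    have := mem_extLeft_bounds hM hpq huv hy
    rw [kappa_apply (by omega)]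
    refine ⟨by omega, by omega, ?_⟩
    rwa [show p + q - (p + q - y) = y by omega]
  · rintro ⟨h1, h2, h3⟩
    refine ⟨_, h3, ?_⟩
    rw [kappa_apply (by omega)]
    omega

/-- A modified involution respects the parts and exchanges left and right halves. -/
theorem modified_bounds (hM : ∀ i ∈ M, ∃ j, IsHalfArc P i j)
    (hσ : IsModifiedInvolution P M σ) (hpq : Finset.Icc p q ∈ P.parts) {x : ℕ}
    (hx : p ≤ x ∧ x ≤ q) : (p ≤ σ x ∧ σ x ≤ q) ∧ (σ x < x → p + q ≤ 2 * x) ∧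
      (x < σ x → 2 * x ≤ p + q) := by
  by_cases h : ∃ u v, IsMarkComponent M p q u v ∧ x ∈ extComponent p q u v
  · obtain ⟨u, v, huv, hxE⟩ := h
    by_cases hfix : σ x = x
    · rw [hfix]; exact ⟨hx, by omega, by omega⟩
    · rcases (hσ.modified p q hpq u v huv).opposite x hxE hfix with ⟨h1, h2⟩ | ⟨h1, h2⟩
      · rw [mem_extRight_iff hM hpq huv] at h2
        have h3 := mem_extLeft_bounds hM hpq huv h1
        have h4 := mem_extLeft_bounds hM hpq huv h2.2.2
        omega
      · rw [mem_extRight_iff hM hpq huv] at h1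
        have h3 := mem_extLeft_bounds hM hpq huv h1.2.2
        have h4 := mem_extLeft_bounds hM hpq huv h2
        omega
  · push Not at h
    rw [hσ.unmodified p q hpq x hx h, kappa_apply hx]
    omega

/-- All arcs inside the reflection of a fixed point are marked. -/
theorem mem_mark_of_fixed (hM : ∀ i ∈ M, ∃ j, IsHalfArc P i j)
    (hσ : IsModifiedInvolution P M σ) (hpq : Finset.Icc p q ∈ P.parts) {z : ℕ}
    (hz : p ≤ z ∧ z ≤ q) (hfix : σ z = z) {i : ℕ} (hi : z ≤ i ∨ p + q - z ≤ i)
    (hic : 2 * i + 1 ≤ p + q) : i ∈ M := by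
  by_cases h : ∃ u v, IsMarkComponent M p q u v ∧ z ∈ extComponent p q u v
  · obtain ⟨u, v, huv, hzE⟩ := h
    have hT := hσ.modified p q hpq u v huv
    -- An extended component containing a fixed point cannot be a loop, so its marks reach the
    -- innermost arc.
    have hv : ¬ 2 * v + 2 < p + q := by
      intro hlt
      have hm := hT.meander
      rw [if_pos hlt] at hm
      exact hm.2 (isEdge_of_fixed (kappa_mul_self p q)
        (Equiv.ext fun x => hσ.involutive x) hm.1 hzE hfix)
    have hu : u ≤ i := by
      rcases hzE with h1 | h1
      · have := mem_extLeft_bounds hM hpq huv h1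
        omega
      · rw [mem_extRight_iff hM hpq huv] at h1
        have := mem_extLeft_bounds hM hpq huv h1.2.2
        omega
    exact huv.2.2.2.1 i ⟨hu, by omega⟩
  · push Not at h
    -- Otherwise `z` is the centre of the part, and no `i` satisfies both bounds.
    have := hσ.unmodified p q hpq z hz h
    rw [hfix, kappa_apply hz] at this
    omega

/-- If the centre of a part is moved then the innermost arc is marked. -/
theorem pred_mem_mark_of_ne (hM : ∀ i ∈ M, ∃ j, IsHalfArc P i j)
    (hσ : IsModifiedInvolution P M σ) (hpq : Finset.Icc p q ∈ P.parts) {x : ℕ}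
    (hx : p ≤ x ∧ x ≤ q) (hc : 2 * x = p + q) (hne : σ x ≠ x) : x - 1 ∈ M := by
  by_cases h : ∃ u v, IsMarkComponent M p q u v ∧ x ∈ extComponent p q u v
  · obtain ⟨u, v, huv, hxE⟩ := h
    have hv := huv.2.2.2.1 v ⟨huv.2.1, le_rfl⟩
    have hle := mark_le hM hpq hv ⟨huv.1.trans huv.2.1, huv.2.2.1⟩
    have hxv : x = v + 1 := by
      rcases hxE with h1 | h1
      · have := mem_extLeft_bounds hM hpq huv h1
        omega
      · rw [mem_extRight_iff hM hpq huv] at h1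
        have := mem_extLeft_bounds hM hpq huv h1.2.2
        omega
    rw [hxv, Nat.add_sub_cancel]
    exact hv
  · push Not at h
    have := hσ.unmodified p q hpq x hx h
    rw [kappa_apply hx] at this
    omega

end

/-! ### Order of opposite turning points inside a part. -/

section

variable {n : ℕ} {J : Bool → Finpartition (Finset.Icc 1 n)} {M : Bool → Set ℕ}
  {σ : Bool → Equiv.Perm ℕ}

theorem SameHalfMeander.of_isHalfArc {b : Bool} {i j : ℕ} (h : IsHalfArc (J b) i j) :
    SameHalfMeander J i j :=
  Relation.EqvGen.rel _ _ ⟨b, h⟩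

theorem mark_unique (hM : IsMarking J M) {c c' : Bool} {i j : ℕ} (hi : i ∈ M c) (hj : j ∈ M c')
    (h : SameHalfMeander J i j) : c = c' ∧ i = j := by
  obtain ⟨k, p, q, hpq, h1, h2, h3⟩ := hM.isArc c i hi
  have hn := part_subset hpq (x := i) ⟨h1, by omega⟩
  have hn' := part_subset hpq (x := i + 1) ⟨by omega, by omega⟩
  have := (hM.existsUnique i ⟨hn.1, by omega⟩).unique (y₁ := (c, i)) (y₂ := (c', j))
    ⟨hi, Relation.EqvGen.refl _⟩ ⟨hj, h⟩
  simpa using this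

/-- If `z < x`, the fixed point `z` forces marks at all `i` in `[z, x)`. The centre of the part of
`x` on the other side is at most `x`, and each possible position of it contradicts the uniqueness of
marks or the rule for ends. -/
theorem not_lt_of_fixed (hJ : ∀ b, IsConnectedPartition (J b)) (hM : IsMarking J M)
    (hσ : ∀ b, IsModifiedInvolution (J b) (M b) (σ b)) {b : Bool} {x z : ℕ}
    (hS : SamePart (J b) x z) (hx : x < σ b x) (hx' : σ (!b) x < x) (hz : σ b z = z)
    (hz' : z < σ (!b) z) : ¬ z < x := by
  intro hlt
  have hb : b ≠ !b := by cases b <;> simp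
  obtain ⟨p, q, hpq, hxp, hzp⟩ := hS
  have hxc := (modified_bounds (hM.isArc b) (hσ b) hpq hxp).2.2 hx
  have hmark : ∀ i, z ≤ i → i < x → i ∈ M b := fun i h1 h2 =>
    mem_mark_of_fixed (hM.isArc b) (hσ b) hpq hzp hz (Or.inl h1) (by omega)
  obtain ⟨p', q', hpq', hxp'⟩ := exists_part (hJ (!b)) (Finset.mem_Icc.2 (part_subset hpq hxp))
  obtain ⟨h1, h2, -⟩ := modified_bounds (hM.isArc (!b)) (hσ (!b)) hpq' hxp'
  have h2 := h2 hx'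
  -- If the other centre is not to the right of `z`, then `z` must be that centre and is moved, so
  -- `z - 1` is marked there while `z` is marked on side `b`. These two half-integer points are
  -- joined by an arc.
  rcases le_or_gt (p' + q') (2 * z) with hc | hc
  · have hzp' : p' ≤ z ∧ z ≤ q' := by omega
    obtain ⟨h3, -, h4⟩ := modified_bounds (hM.isArc (!b)) (hσ (!b)) hpq' hzp'
    have h4 := h4 hz'
    have h5 := pred_mem_mark_of_ne (hM.isArc (!b)) (hσ (!b)) hpq' hzp' (by omega) hz'.ne'
    have harc : IsHalfArc (J (!b)) (z - 1) z := ⟨p', q', hpq', by omega, by omega, by omega⟩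
    exact hb (mark_unique hM h5 (hmark z le_rfl hlt) (.of_isHalfArc harc)).1.symm
  · rcases Nat.even_or_odd' (p' + q') with ⟨k, hk | hk⟩
    -- The centre is the integer `k`. The innermost half-integer arc around it joins `k - 1` to `k`,
    -- giving two marks on one meander; when `k = x` the second mark comes from the other side.
    · have harc : IsHalfArc (J (!b)) (k - 1) k := ⟨p', q', hpq', by omega, by omega, by omega⟩
      have h3 := hmark (k - 1) (by omega) (by omega)
      rcases Nat.lt_or_ge k x with hkx | hkx
      · have := (mark_unique hM h3 (hmark k (by omega) hkx) (.of_isHalfArc harc)).2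
        omega
      · obtain rfl : k = x := by omega
        have h5 := pred_mem_mark_of_ne (hM.isArc (!b)) (hσ (!b)) hpq' hxp' (by omega) hx'.ne
        exact hb (mark_unique hM h3 h5 (.refl _)).1
    -- The half-integer centre is a fixed point, so the mark at `k` on side `b` must be central as
    -- well. But `k < x`, and `x` is not beyond the centre of `[p, q]`.
    · have harc : IsHalfArc (J (!b)) k k := ⟨p', q', hpq', by omega, by omega, by omega⟩
      obtain ⟨p₁, q₁, h6, h7, h8, h9⟩ := hM.isEnd b k (hmark k (by omega) (by omega))
        ⟨k, .refl _, _, harc⟩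
      obtain ⟨rfl, rfl⟩ := part_unique hpq h6 (x := k) (by omega) (by omega)
      omega

/-- This mirrors `not_lt_of_fixed`, but marks are recorded by left ends. The arcs met to the right
of the centre are therefore first reflected to `p + q - 1 - i`, which stays on the same half-integer
meander. -/
theorem not_gt_of_fixed (hJ : ∀ b, IsConnectedPartition (J b)) (hM : IsMarking J M)
    (hσ : ∀ b, IsModifiedInvolution (J b) (M b) (σ b)) {b : Bool} {x z : ℕ}
    (hS : SamePart (J b) x z) (hx : σ b x < x) (hx' : x < σ (!b) x) (hz : σ b z = z)
    (hz' : σ (!b) z < z) : ¬ x < z := by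
  intro hlt
  have hb : b ≠ !b := by cases b <;> simp
  obtain ⟨p, q, hpq, hxp, hzp⟩ := hS
  have hxc := (modified_bounds (hM.isArc b) (hσ b) hpq hxp).2.1 hx
  have hmark : ∀ i, x ≤ i → i < z → p + q - 1 - i ∈ M b ∧ SameHalfMeander J (p + q - 1 - i) i :=
    fun i h1 h2 => ⟨mem_mark_of_fixed (hM.isArc b) (hσ b) hpq hzp hz (Or.inr (by omega)) (by omega),
      .of_isHalfArc (b := b) ⟨p, q, hpq, by omega, by omega, by omega⟩⟩
  obtain ⟨p', q', hpq', hxp'⟩ := exists_part (hJ (!b)) (Finset.mem_Icc.2 (part_subset hpq hxp))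
  obtain ⟨h1, -, h2⟩ := modified_bounds (hM.isArc (!b)) (hσ (!b)) hpq' hxp'
  have h2 := h2 hx'
  rcases le_or_gt (2 * z) (p' + q') with hc | hc
  · have hzp' : p' ≤ z ∧ z ≤ q' := by omega
    obtain ⟨h3, h4, -⟩ := modified_bounds (hM.isArc (!b)) (hσ (!b)) hpq' hzp'
    have h4 := h4 hz'
    have h5 := pred_mem_mark_of_ne (hM.isArc (!b)) (hσ (!b)) hpq' hzp' (by omega) hz'.ne
    obtain ⟨h6, h7⟩ := hmark (z - 1) (by omega) (by omega)
    exact hb (mark_unique hM h6 h5 h7).1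
  · rcases Nat.even_or_odd' (p' + q') with ⟨k, hk | hk⟩
    · have harc : IsHalfArc (J (!b)) (k - 1) k := ⟨p', q', hpq', by omega, by omega, by omega⟩
      obtain ⟨h3, h4⟩ := hmark k (by omega) (by omega)
      have h5 : SameHalfMeander J (k - 1) (p + q - 1 - k) :=
        .trans _ _ _ (SameHalfMeander.of_isHalfArc harc) (.symm _ _ h4)
      rcases Nat.lt_or_ge x k with hkx | hkx
      · obtain ⟨h6, h7⟩ := hmark (k - 1) (by omega) (by omega)
        have := (mark_unique hM h6 h3 (.trans _ _ _ h7 h5)).2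
        omega
      · obtain rfl : k = x := by omega
        have h6 := pred_mem_mark_of_ne (hM.isArc (!b)) (hσ (!b)) hpq' hxp' (by omega) hx'.ne'
        exact hb (mark_unique hM h6 h3 h5).1.symm
    · have harc : IsHalfArc (J (!b)) k k := ⟨p', q', hpq', by omega, by omega, by omega⟩
      obtain ⟨h3, h4⟩ := hmark k (by omega) (by omega)
      obtain ⟨p₁, q₁, h6, h7, h8, h9⟩ := hM.isEnd b _ h3 ⟨k, h4, _, harc⟩
      obtain ⟨rfl, rfl⟩ := part_unique hpq h6 (x := p + q - 1 - k) (by omega) (by omega)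
      omega

/-- In a part, turning points of opposite types are ordered: for upper parts sources are to the
left of sinks, for lower parts to the right. Here `x` is an internal turning point and `z` may be an
end-point. -/
theorem before_of_opposite (hJ : ∀ b, IsConnectedPartition (J b)) (hM : IsMarking J M)
    (hσ : ∀ b, IsModifiedInvolution (J b) (M b) (σ b)) {b d : Bool} {x z : ℕ}
    (hS : SamePart (J b) x z) (hx : ∀ c, Before (c == d) x (σ c x))
    (hz : ∀ c, σ c z ≠ z → Before (c == d) (σ c z) z) (hmove : ∃ c, σ c z ≠ z)
    (hxz : x ≠ z) : Before (b == d) x z := by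
  have hx1 := hx b
  have hx2 := hx (!b)
  obtain ⟨p, q, hpq, hxp, hzp⟩ := id hS
  have hbx := (modified_bounds (hM.isArc b) (hσ b) hpq hxp).2
  have hbz := (modified_bounds (hM.isArc b) (hσ b) hpq hzp).2
  have hnot : ((!b) == d) = !(b == d) := by cases b <;> cases d <;> rfl
  rw [hnot] at hx2
  by_cases hfix : σ b z = z
  · have hne : σ (!b) z ≠ z := by
      obtain ⟨c, hc⟩ := hmove
      rcases Bool.eq_or_eq_not c b with rfl | rfl
      · exact absurd hfix hc
      · exact hc
    have hz2 := hz (!b) hne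
    rw [hnot] at hz2
    cases hbd : (b == d) <;> simp [hbd, Before] at hx1 hx2 hz2 ⊢
    · have := not_gt_of_fixed hJ hM hσ hS hx1 hx2 hfix hz2
      omega
    · have := not_lt_of_fixed hJ hM hσ hS hx1 hx2 hfix hz2
      omega
  -- Both points are moved by `σ b`, towards opposite directions, so they lie on opposite sides of
  -- the centre.
  · have hz1 := hz b hfix
    cases hbd : (b == d) <;> simp [hbd, Before] at hx1 hz1 ⊢ <;> omega

end

/-! ### The enumeration of an edge -/

theorem before_not (b : Bool) (x y : ℕ) : Before (!b) x y ↔ Before b y x := by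
  cases b <;> simp [Before]

theorem not_beq (b d : Bool) : ((!b) == d) = !(b == d) := by
  cases b <;> cases d <;> rfl

theorem beq_not (b d : Bool) : (b == !d) = !(b == d) := by
  cases b <;> cases d <;> rfl

theorem Before.trans {b : Bool} {x y z : ℕ} (h : Before b x y) (h' : Before b y z) :
    Before b x z := by
  cases b <;> simp [Before] at * <;> omega

theorem Before.asymm {b : Bool} {x y : ℕ} (h : Before b x y) : ¬ Before b y x := by
  cases b <;> simp [Before] at * <;> omega

theorem before_or {x y : ℕ} (b : Bool) (h : x ≠ y) : Before b x y ∨ Before b y x := by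
  cases b <;> simp [Before] at * <;> omega

theorem root_eq_root {x y r s : ℕ} (hxy : x ≠ y) (h : root x y = root r s) : x = r ∧ y = s := by
  have h1 := congrFun h x
  have h2 := congrFun h y
  simp only [root_apply, hxy, hxy.symm, if_true, if_false] at h1 h2
  split_ifs at h1 h2 <;> omega

theorem root_mem_rootsS_iff {σ : Bool → Equiv.Perm ℕ} {x y : ℕ} (hxy : x ≠ y) :
    root x y ∈ rootsS σ ↔ ∃ c, σ c x = y ∧ Before c x y := by
  constructor
  · rintro (⟨i, hi, h⟩ | ⟨i, hi, h⟩)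
    · obtain ⟨rfl, rfl⟩ := root_eq_root hxy h
      exact ⟨true, rfl, hi⟩
    · obtain ⟨rfl, rfl⟩ := root_eq_root hxy h
      exact ⟨false, rfl, hi⟩
  · rintro ⟨c, rfl, h⟩
    cases c
    · exact Or.inr ⟨x, h, rfl⟩
    · exact Or.inl ⟨x, h, rfl⟩

section

variable {σ : Bool → Equiv.Perm ℕ} {a : ℕ}

theorem stepSide_succ (t : ℕ) : stepSide σ a (t + 1) = !stepSide σ a t := by
  unfold stepSide
  simp only [Nat.odd_add_one]
  by_cases h1 : σ true a = a <;> by_cases h2 : Odd t <;> simp [h1, h2]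

theorem phi_succ {t : ℕ} (ht : 1 ≤ t) : phi σ a (t + 1) = σ (stepSide σ a t) (phi σ a t) := by
  obtain ⟨k, rfl⟩ : ∃ k, t = k + 1 := ⟨t - 1, by omega⟩
  rfl

theorem phi_pred (hinv : ∀ b x, σ b (σ b x) = x) {t : ℕ} (ht : 1 ≤ t) :
    σ (stepSide σ a t) (phi σ a (t + 1)) = phi σ a t := by
  rw [phi_succ ht, hinv]

theorem fixed_start (hfix : σ true a = a ∨ σ false a = a) : σ (!stepSide σ a 1) a = a := by
  unfold stepSide
  by_cases h : σ true a = a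
  · simp [h]
  · simpa [h] using hfix.resolve_left h

/-- The data of an enumerated edge `φ(1), …, φ(e)`. -/
structure IsEnumeration (σ : Bool → Equiv.Perm ℕ) (a e : ℕ) (E : Set ℕ) : Prop where
  involutive : ∀ b x, σ b (σ b x) = x
  start : σ (!stepSide σ a 1) a = a
  fixed_end : σ (stepSide σ a e) (phi σ a e) = phi σ a e
  injOn : Set.InjOn (phi σ a) (Set.Icc 1 e)
  image_eq : phi σ a '' Set.Icc 1 e = E
  one_lt : 1 < e

/-- By finiteness some value is repeated; take the first repetition. Unless the walk is stationary
there, going back along the same side produces an earlier repetition. -/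
theorem exists_phi_fixed (hinv : ∀ b x, σ b (σ b x) = x) (hstart : σ (!stepSide σ a 1) a = a)
    {E : Set ℕ} (hE : E.Finite) (hmem : ∀ t, 1 ≤ t → phi σ a t ∈ E) :
    ∃ T, 1 ≤ T ∧ Set.InjOn (phi σ a) (Set.Icc 1 T) ∧
      σ (stepSide σ a T) (phi σ a T) = phi σ a T := by
  classical
  have hex : ∃ T, 1 ≤ T ∧ ∃ j, 1 ≤ j ∧ j ≤ T ∧ phi σ a (T + 1) = phi σ a j := by
    have := hE.to_subtype
    obtain ⟨i, j, hij, h⟩ := Finite.exists_ne_map_eq_of_infinite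
      fun k : ℕ => (⟨phi σ a (k + 1), hmem _ (by omega)⟩ : E)
    have h : phi σ a (i + 1) = phi σ a (j + 1) := congrArg Subtype.val h
    rcases lt_or_gt_of_ne hij with hlt | hlt
    · exact ⟨j, by omega, i + 1, by omega, by omega, h.symm⟩
    · exact ⟨i, by omega, j + 1, by omega, by omega, h⟩
  obtain ⟨hT1, j, hj1, hjT, hj⟩ := Nat.find_spec hex
  have hmin := fun m hm => Nat.find_min hex (m := m) hm
  generalize Nat.find hex = T at *
  have hlt : ∀ i k, 1 ≤ i → i < k → k ≤ T → phi σ a i ≠ phi σ a k := by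
    intro i k h1 h2 h3 h
    refine hmin (k - 1) (by omega) ⟨by omega, i, h1, by omega, ?_⟩
    rw [show k - 1 + 1 = k by omega, h]
  refine ⟨T, hT1, ?_, ?_⟩
  · rintro i ⟨h1, h2⟩ k ⟨h3, h4⟩ h
    rcases lt_trichotomy i k with hik | hik | hik
    · exact absurd h (hlt i k h1 hik h4)
    · exact hik
    · exact absurd h.symm (hlt k i h3 hik h2)
  · rw [← phi_succ hT1, hj]
    rcases Nat.lt_or_ge j T with hjT' | hjT'
    swap
    · rw [le_antisymm hjT hjT']
    exfalso
    -- Thus `phi σ a T` is a neighbour of `phi σ a j`, namely the next or previous point, or `a`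
    -- itself when `j = 1`; each case contradicts minimality or the alternation of sides.
    have hTj : phi σ a T = σ (stepSide σ a T) (phi σ a j) := by
      rw [← hj, phi_pred hinv hT1]
    rcases Bool.eq_or_eq_not (stepSide σ a T) (stepSide σ a j) with hs | hs
    · rw [hs, ← phi_succ hj1] at hTj
      rcases Nat.lt_or_ge (j + 1) T with h | h
      · exact hlt _ _ (by omega) h le_rfl hTj.symm
      · rw [show T = j + 1 by omega, stepSide_succ] at hs
        simp at hs
    · rcases Nat.lt_or_ge 1 j with h | h
      · obtain ⟨k, rfl⟩ : ∃ k, j = k + 1 := ⟨j - 1, by omega⟩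
        rw [hs, stepSide_succ, Bool.not_not, phi_pred hinv (by omega)] at hTj
        exact hlt k T (by omega) (by omega) le_rfl hTj.symm
      · obtain rfl : j = 1 := by omega
        rw [hs] at hTj
        exact hlt 1 T le_rfl hjT' le_rfl (hTj.trans hstart).symm

theorem isEnumeration_of_edge (hinv : ∀ b x, σ b (σ b x) = x) {E : Set ℕ}
    (hE : IsMeander (σ true) (σ false) E) (hfin : E.Finite) (hnt : E.Nontrivial) (ha : a ∈ E)
    (hfix : σ true a = a ∨ σ false a = a) : IsEnumeration σ a E.ncard E := by
  have hstart := fixed_start hfix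
  obtain ⟨x, rfl⟩ := hE
  have hmul : ∀ b, σ b * σ b = 1 := fun b => Equiv.ext (hinv b)
  have hstab : ∀ b, ∀ y ∈ MulAction.orbit (Subgroup.closure {σ true, σ false}) x,
      σ b y ∈ MulAction.orbit (Subgroup.closure {σ true, σ false}) x := by
    intro b y hy
    have hb : σ b ∈ Subgroup.closure {σ true, σ false} :=
      Subgroup.subset_closure (by cases b <;> simp)
    exact MulAction.mem_orbit_of_mem_orbit (⟨σ b, hb⟩ : Subgroup.closure {σ true, σ false}) hy
  have hmem : ∀ t, 1 ≤ t →
      phi σ a t ∈ MulAction.orbit (Subgroup.closure {σ true, σ false}) x := by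
    intro t ht
    induction t, ht using Nat.le_induction with
    | base => exact ha
    | succ t ht ih => rw [phi_succ ht]; exact hstab _ _ ih
  obtain ⟨T, hT1, hinj, hend⟩ := exists_phi_fixed hinv hstart hfin hmem
  have himg : phi σ a '' Set.Icc 1 T =
      MulAction.orbit (Subgroup.closure {σ true, σ false}) x := by
    apply Set.Subset.antisymm
    · rintro _ ⟨t, ht, rfl⟩
      exact hmem t ht.1
    · rw [← MulAction.orbit_eq_iff.2 ha]
      have hst : ∀ c, ∀ y ∈ phi σ a '' Set.Icc 1 T, σ c y ∈ phi σ a '' Set.Icc 1 T := by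
        rintro c _ ⟨t, ⟨ht1, htT⟩, rfl⟩
        rcases Bool.eq_or_eq_not c (stepSide σ a t) with rfl | rfl
        · rcases Nat.lt_or_ge t T with h | h
          · exact ⟨t + 1, ⟨by omega, by omega⟩, phi_succ ht1⟩
          · obtain rfl : t = T := by omega
            exact ⟨t, ⟨ht1, le_rfl⟩, hend.symm⟩
        · rcases Nat.lt_or_ge 1 t with h | h
          · obtain ⟨k, rfl⟩ : ∃ k, t = k + 1 := ⟨t - 1, by omega⟩
            rw [stepSide_succ, Bool.not_not, phi_pred hinv (by omega)]
            exact ⟨k, ⟨by omega, by omega⟩, rfl⟩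
          · obtain rfl : t = 1 := by omega
            exact ⟨1, ⟨le_rfl, hT1⟩, hstart.symm⟩
      exact orbit_subset_of_stable (hmul true) (hmul false) (hst true) (hst false)
        ⟨1, ⟨le_rfl, hT1⟩, rfl⟩
  have hcard : (MulAction.orbit (Subgroup.closure {σ true, σ false}) x).ncard = T := by
    rw [← himg, hinj.ncard_image, ← Finset.coe_Icc, Set.ncard_coe_finset]
    simp
  have := hfin.to_subtype
  have hlt := Set.one_lt_ncard_iff_nontrivial.2 hnt
  rw [hcard] at hlt ⊢
  exact ⟨hinv, hstart, hend, hinj, himg, hlt⟩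

open Classical in
/-- The direction of the arrow of the `i`-th arc of an edge. -/
noncomputable def arrow (σ : Bool → Equiv.Perm ℕ) (a i : ℕ) : Bool :=
  decide (Before (stepSide σ a i) (phi σ a i) (phi σ a (i + 1)))

variable {e : ℕ} {E : Set ℕ}

theorem IsEnumeration.phi_ne (h : IsEnumeration σ a e E) {i j : ℕ} (hi : 1 ≤ i ∧ i ≤ e)
    (hj : 1 ≤ j ∧ j ≤ e) (hij : i ≠ j) : phi σ a i ≠ phi σ a j :=
  fun heq => hij (h.injOn hi hj heq)

theorem arrow_eq_true_iff (i : ℕ) :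
    arrow σ a i = true ↔ Before (stepSide σ a i) (phi σ a i) (phi σ a (i + 1)) := by
  simp [arrow]

theorem IsEnumeration.before_arrow (h : IsEnumeration σ a e E) {i : ℕ} (h1 : 1 ≤ i) (hi : i < e) :
    Before (stepSide σ a i == arrow σ a i) (phi σ a i) (phi σ a (i + 1)) := by
  have hne := h.phi_ne (i := i) (j := i + 1) ⟨h1, by omega⟩ ⟨by omega, hi⟩ (by omega)
  by_cases hb : Before (stepSide σ a i) (phi σ a i) (phi σ a (i + 1))
  · simp [arrow, hb]
  · have := (before_or (stepSide σ a i) hne).resolve_left hb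
    simpa [arrow, hb, before_not] using this

theorem IsEnumeration.sigma_phi (h : IsEnumeration σ a e E) {k : ℕ} (hk : 1 ≤ k ∧ k ≤ e)
    (c : Bool) : (c = stepSide σ a k ∧ k < e ∧ σ c (phi σ a k) = phi σ a (k + 1)) ∨
      (c = stepSide σ a (k - 1) ∧ 1 < k ∧ σ c (phi σ a k) = phi σ a (k - 1)) ∨
      σ c (phi σ a k) = phi σ a k := by
  rcases Bool.eq_or_eq_not c (stepSide σ a k) with rfl | rfl
  · rcases Nat.lt_or_ge k e with hlt | hle
    · exact Or.inl ⟨rfl, hlt, (phi_succ hk.1).symm⟩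
    · obtain rfl : k = e := by omega
      exact Or.inr (Or.inr h.fixed_end)
  · rcases Nat.lt_or_ge 1 k with hlt | hle
    · obtain ⟨k, rfl⟩ : ∃ j, k = j + 1 := ⟨k - 1, by omega⟩
      rw [stepSide_succ, Bool.not_not, phi_pred h.involutive (by omega)]
      exact Or.inr (Or.inl ⟨rfl, hlt, rfl⟩)
    · obtain rfl : k = 1 := by omega
      exact Or.inr (Or.inr h.start)

theorem IsEnumeration.beta_mem_iff (h : IsEnumeration σ a e E) {i : ℕ} (h1 : 1 ≤ i) (hi : i < e) :
    beta σ a i ∈ rootsS σ ↔ arrow σ a i = true := by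
  have hne := h.phi_ne (i := i) (j := i + 1) ⟨h1, by omega⟩ ⟨by omega, hi⟩ (by omega)
  rw [beta, root_mem_rootsS_iff hne, arrow_eq_true_iff]
  constructor
  · rintro ⟨c, hc, hb⟩
    rcases h.sigma_phi (k := i) ⟨h1, by omega⟩ c with ⟨rfl, -, -⟩ | ⟨-, h2, h3⟩ | h3
    · exact hb
    · exact absurd (h3.symm.trans hc) (h.phi_ne ⟨by omega, by omega⟩ ⟨by omega, by omega⟩ (by omega))
    · exact absurd (h3.symm.trans hc) hne
  · exact fun hb => ⟨_, (phi_succ h1).symm, hb⟩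

theorem IsEnumeration.eps_eq (h : IsEnumeration σ a e E) {i : ℕ} (h1 : 1 ≤ i) (hi : i < e) :
    eps σ a i = if arrow σ a i then 1 else -1 := by
  simp only [eps, h.beta_mem_iff h1 hi]

theorem IsEnumeration.eps_smul_root (h : IsEnumeration σ a e E) {i : ℕ} (h1 : 1 ≤ i) (hi : i < e)
    (x y : ℕ) : eps σ a i • root (phi σ a x) (phi σ a y) =
      root (phi σ a (orient (arrow σ a i) (x, y)).1) (phi σ a (orient (arrow σ a i) (x, y)).2) := by
  rw [h.eps_eq h1 hi]
  cases arrow σ a i <;> simp [orient, neg_root]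

theorem IsEnumeration.image_eps_smul_beta (h : IsEnumeration σ a e E) :
    (fun i => eps σ a i • beta σ a i) '' Set.Ico 1 e = rootsSOn σ E := by
  ext γ
  constructor
  · rintro ⟨i, ⟨h1, hi⟩, rfl⟩
    have hne := h.phi_ne (i := i) (j := i + 1) ⟨h1, by omega⟩ ⟨by omega, hi⟩ (by omega)
    have hm1 : phi σ a i ∈ E := h.image_eq ▸ ⟨i, ⟨h1, by omega⟩, rfl⟩
    have hm2 : phi σ a (i + 1) ∈ E := h.image_eq ▸ ⟨i + 1, ⟨by omega, hi⟩, rfl⟩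
    have hb := h.before_arrow h1 hi
    simp only [beta]
    rw [h.eps_smul_root h1 hi]
    cases hd : arrow σ a i
    · simp only [hd] at hb
      refine ⟨(root_mem_rootsS_iff hne.symm).2 ⟨stepSide σ a i, phi_pred h.involutive h1, ?_⟩,
        _, hm2, _, hm1, hne.symm, rfl⟩
      simpa [before_not] using hb
    · simp only [hd] at hb
      refine ⟨(root_mem_rootsS_iff hne).2 ⟨stepSide σ a i, (phi_succ h1).symm, ?_⟩,
        _, hm1, _, hm2, hne, rfl⟩
      simpa using hb
  · rintro ⟨hS, u, hu, v, hv, huv, rfl⟩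
    obtain ⟨c, rfl, hb⟩ := (root_mem_rootsS_iff huv).1 hS
    rw [← h.image_eq] at hu
    obtain ⟨k, ⟨hk1, hke⟩, rfl⟩ := hu
    rcases h.sigma_phi ⟨hk1, hke⟩ c with ⟨-, h2, h3⟩ | ⟨hc, h2, h3⟩ | h3
    · refine ⟨k, ⟨hk1, h2⟩, ?_⟩
      rw [h3] at hS ⊢
      have := (h.beta_mem_iff hk1 h2).1 hS
      simp [h.eps_eq hk1 h2, this, beta]
    · obtain ⟨j, rfl⟩ : ∃ j, k = j + 1 := ⟨k - 1, by omega⟩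
      rw [Nat.add_sub_cancel] at hc h3
      refine ⟨j, ⟨by omega, by omega⟩, ?_⟩
      have hnS : ¬ arrow σ a j = true := by
        rw [arrow_eq_true_iff]
        rw [h3, hc] at hb
        exact hb.asymm
      simp [h.eps_eq (i := j) (by omega) (by omega), hnS, beta, h3, neg_root]
    · exact absurd h3.symm huv

end

/-! ### Turning points of an edge -/

section

variable {e : ℕ} {d : ℕ → Bool}

theorem HasType.eq {b : Bool} {t : ℕ} (h : HasType e d b t) (ht : t < e) : b = d t :=
  (h.2.2.1 ht).symm

/-- The required point is the next change of direction, or `e` if there is none. -/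
theorem exists_hasType_gt {t : ℕ} (h1 : 1 ≤ t) (ht : t < e) : ∃ s, t < s ∧ HasType e d (!d t) s := by
  classical
  have hex : ∃ s, t < s ∧ (s = e ∨ d s ≠ d t) := ⟨e, ht, Or.inl rfl⟩
  obtain ⟨hs1, hs2⟩ := Nat.find_spec hex
  have hmin := fun m hm => Nat.find_min hex (m := m) hm
  have hle := Nat.find_min' hex ⟨ht, Or.inl rfl⟩
  generalize Nat.find hex = s at *
  refine ⟨s, hs1, by omega, hle, fun hse => ?_, fun _ => ?_⟩
  · rcases hs2 with rfl | hs2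
    · omega
    · revert hs2; cases d s <;> cases d t <;> simp
  · rw [Bool.not_not]
    by_contra hne
    rcases Nat.lt_or_ge t (s - 1) with h | h
    · exact hmin (s - 1) (by omega) ⟨h, Or.inr hne⟩
    · exact hne (by rw [show s - 1 = t by omega])

/-- The required point is the beginning of the straight run arriving at `t`; no step of that run has
the direction `d t`. -/
theorem exists_hasType_lt {t : ℕ} (ht : Turns e d t) :
    ∃ s, s < t ∧ HasType e d (!d t) s ∧ ∀ r, r < t → d r = d t → r < s := by
  classical
  have ht1 := ht.1
  have hte := ht.2.1
  have hpred : d (t - 1) = !d t := (hasType_of_turns ht).2.2.2 ht1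
  have hex : ∃ s, 1 ≤ s ∧ ∀ r, s ≤ r → r < t → d r = !d t :=
    ⟨t - 1, by omega, fun r h1 h2 => by rw [show r = t - 1 by omega, hpred]⟩
  obtain ⟨hs1, hs2⟩ := Nat.find_spec hex
  have hmin := fun m hm => Nat.find_min hex (m := m) hm
  have hle : Nat.find hex ≤ t - 1 := Nat.find_min' hex
    ⟨by omega, fun r h1 h2 => by rw [show r = t - 1 by omega, hpred]⟩
  generalize Nat.find hex = s at *
  refine ⟨s, by omega, ⟨hs1, by omega, fun _ => hs2 s le_rfl (by omega), fun h => ?_⟩, ?_⟩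
  · rw [Bool.not_not]
    by_contra hne
    refine hmin (s - 1) (by omega) ⟨by omega, fun r h1 h2 => ?_⟩
    rcases Nat.lt_or_ge r s with h3 | h3
    · rw [show r = s - 1 by omega]
      revert hne; cases d (s - 1) <;> cases d t <;> simp
    · exact hs2 r h3 h2
  · intro r hr hd
    by_contra hle
    have := hs2 r (by omega) hr
    rw [hd] at this
    simp at this

end

/-! ### Dictionary between an edge and its zigzag. -/

section

variable {σ : Bool → Equiv.Perm ℕ} {a e : ℕ} {E : Set ℕ} {sg : ℕ → ℤ}

/-- Consecutive arcs lie on different sides, where arrows have opposite left-right meaning. Passing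
straight through `φ(t)` on the line is therefore the same as reversing the arrow. -/
theorem IsEnumeration.isInternalTurning_iff (h : IsEnumeration σ a e E) (t : ℕ) :
    IsInternalTurning σ a e t ↔ Turns e (arrow σ a) t := by
  unfold IsInternalTurning Turns
  refine and_congr_right fun h1 => and_congr_right fun h2 => ?_
  obtain ⟨k, rfl⟩ : ∃ k, t = k + 1 := ⟨t - 1, by omega⟩
  have hb1 := h.before_arrow (i := k) (by omega) (by omega)
  have hb2 := h.before_arrow (i := k + 1) (by omega) (by omega)
  rw [stepSide_succ] at hb2
  rw [Nat.add_sub_cancel]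
  generalize stepSide σ a k = b at *
  generalize arrow σ a k = x at *
  generalize arrow σ a (k + 1) = y at *
  cases b <;> cases x <;> cases y <;> simp [Before] at hb1 hb2 ⊢ <;> omega

theorem IsEnumeration.eps_eq_one_iff (h : IsEnumeration σ a e E) {i : ℕ} (h1 : 1 ≤ i) (hi : i < e) :
    eps σ a i = 1 ↔ arrow σ a i = true := by
  rw [h.eps_eq h1 hi]
  cases arrow σ a i <;> simp

theorem IsEnumeration.eps_eq_neg_one_iff (h : IsEnumeration σ a e E) {i : ℕ} (h1 : 1 ≤ i)
    (hi : i < e) : eps σ a i = -1 ↔ arrow σ a i = false := by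
  rw [h.eps_eq h1 hi]
  cases arrow σ a i <;> simp

theorem IsEnumeration.isTurning_of_hasType (h : IsEnumeration σ a e E) {b : Bool} {t : ℕ}
    (ht : HasType e (arrow σ a) b t) : IsTurning σ a e t := by
  by_cases h1 : t = 1
  · exact Or.inl h1
  by_cases h2 : t = e
  · exact Or.inr (Or.inl h2)
  have h3 := ht.1
  have h4 := ht.2.1
  refine Or.inr (Or.inr ((h.isInternalTurning_iff t).2 ⟨by omega, by omega, ?_⟩))
  rw [ht.2.2.1 (by omega), ht.2.2.2 (by omega)]
  cases b <;> simp

theorem IsEnumeration.bounds_of_isTurning (h : IsEnumeration σ a e E) {t : ℕ}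
    (ht : IsTurning σ a e t) : 1 ≤ t ∧ t ≤ e := by
  have := h.one_lt
  rcases ht with rfl | rfl | ht
  · omega
  · omega
  · exact ⟨ht.1.le, ht.2.1.le⟩

theorem IsEnumeration.isSource_iff (h : IsEnumeration σ a e E) (t : ℕ) :
    IsSource σ a e t ↔ HasType e (arrow σ a) true t := by
  constructor
  · rintro ⟨ht, h1, h2⟩
    obtain ⟨h3, h4⟩ := h.bounds_of_isTurning ht
    exact ⟨h3, h4, fun h5 => (h.eps_eq_one_iff h3 h5).1 (h1 h5),
      fun h5 => (h.eps_eq_neg_one_iff (by omega) (by omega)).1 (h2 h5)⟩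
  · intro ht
    exact ⟨h.isTurning_of_hasType ht, fun h5 => (h.eps_eq_one_iff ht.1 h5).2 (ht.2.2.1 h5),
      fun h5 => (h.eps_eq_neg_one_iff (by omega) (by have := ht.2.1; omega)).2 (ht.2.2.2 h5)⟩

theorem IsEnumeration.isSink_iff (h : IsEnumeration σ a e E) (t : ℕ) :
    IsSink σ a e t ↔ HasType e (arrow σ a) false t := by
  constructor
  · rintro ⟨ht, h1, h2⟩
    obtain ⟨h3, h4⟩ := h.bounds_of_isTurning ht
    exact ⟨h3, h4, fun h5 => (h.eps_eq_neg_one_iff h3 h5).1 (h1 h5),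
      fun h5 => (h.eps_eq_one_iff (by omega) (by omega)).1 (h2 h5)⟩
  · intro ht
    exact ⟨h.isTurning_of_hasType ht, fun h5 => (h.eps_eq_neg_one_iff ht.1 h5).2 (ht.2.2.1 h5),
      fun h5 => (h.eps_eq_one_iff (by omega) (by have := ht.2.1; omega)).2 (ht.2.2.2 h5)⟩

theorem IsEnumeration.oppositeType_iff (h : IsEnumeration σ a e E) {t : ℕ}
    (ht : Turns e (arrow σ a) t) (s : ℕ) :
    OppositeType σ a e s t ↔ HasType e (arrow σ a) (!arrow σ a t) s := by
  unfold OppositeType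
  rw [h.isSource_iff, h.isSource_iff, h.isSink_iff, h.isSink_iff]
  have hty := hasType_of_turns ht
  constructor
  · rintro (⟨h1, h2⟩ | ⟨h1, h2⟩)
    · rwa [← h2.eq ht.2.1]
    · rwa [← h2.eq ht.2.1]
  · intro hs
    cases hd : arrow σ a t <;> rw [hd] at hs hty
    · exact Or.inl ⟨hs, hty⟩
    · exact Or.inr ⟨hs, hty⟩

theorem IsEnumeration.sameType_iff (h : IsEnumeration σ a e E) {r t : ℕ}
    (hr : Turns e (arrow σ a) r) (ht : Turns e (arrow σ a) t) :
    SameType σ a e r t ↔ arrow σ a r = arrow σ a t := by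
  unfold SameType
  rw [h.isSource_iff, h.isSource_iff, h.isSink_iff, h.isSink_iff]
  have htr := hasType_of_turns hr
  have htt := hasType_of_turns ht
  constructor
  · rintro (⟨h1, h2⟩ | ⟨h1, h2⟩) <;> rw [← h1.eq hr.2.1, ← h2.eq ht.2.1]
  · intro heq
    cases hd : arrow σ a t <;> rw [heq, hd] at htr <;> rw [hd] at htt
    · exact Or.inr ⟨htr, htt⟩
    · exact Or.inl ⟨htr, htt⟩

theorem IsEnumeration.isLeast_crossedPos (h : IsEnumeration σ a e E) {t : ℕ}
    (ht : Turns e (arrow σ a) t) :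
    IsLeast {s | t < s ∧ HasType e (arrow σ a) (!arrow σ a t) s} (crossedPos σ a e t) := by
  have : crossedPos σ a e t = sInf {s | t < s ∧ HasType e (arrow σ a) (!arrow σ a t) s} := by
    simp only [crossedPos, h.oppositeType_iff ht]
  rw [this]
  exact ⟨Nat.sInf_mem (exists_hasType_gt ht.1.le ht.2.1), fun s hs => Nat.sInf_le hs⟩

/-- Being beyond the supremum of `negativeAbove` means being beyond each of its members, which
unifies the two cases of the definition. The start of the run arriving at `t` shows that candidates
exist. -/
theorem IsEnumeration.isLeast_crossedNeg (h : IsEnumeration σ a e E) {t : ℕ}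
    (ht : Turns e (arrow σ a) t) :
    IsLeast {s | HasType e (arrow σ a) (!arrow σ a t) s ∧ ∀ r < t, Turns e (arrow σ a) r →
      sg r = -1 → arrow σ a r = arrow σ a t → r < s} (crossedNeg σ a e sg t) := by
  have hneg : ∀ r, r ∈ negativeAbove σ a e sg t ↔
      r < t ∧ Turns e (arrow σ a) r ∧ sg r = -1 ∧ arrow σ a r = arrow σ a t := by
    intro r
    simp only [negativeAbove, Set.mem_ofPred_eq, h.isInternalTurning_iff]
    constructor
    · rintro ⟨h1, h2, h3, h4⟩
      exact ⟨h1, h2, h4, (h.sameType_iff h2 ht).1 h3⟩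
    · rintro ⟨h1, h2, h3, h4⟩
      exact ⟨h1, h2, (h.sameType_iff h2 ht).2 h4, h3⟩
  have : crossedNeg σ a e sg t = sInf {s | HasType e (arrow σ a) (!arrow σ a t) s ∧ ∀ r < t,
      Turns e (arrow σ a) r → sg r = -1 → arrow σ a r = arrow σ a t → r < s} := by
    unfold crossedNeg
    split_ifs with hne
    · congr 1
      ext s
      have hbdd : BddAbove (negativeAbove σ a e sg t) := ⟨t, fun r hr => hr.1.le⟩
      have hmem := (hneg _).1 (Nat.sSup_mem hne hbdd)
      simp only [Set.mem_ofPred_eq, h.oppositeType_iff ht]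
      rw [and_comm]
      refine and_congr_right fun _ => ⟨fun hs r h1 h2 h3 h4 => ?_, fun hs => ?_⟩
      · exact (le_csSup hbdd ((hneg r).2 ⟨h1, h2, h3, h4⟩)).trans_lt hs
      · exact hs _ hmem.1 hmem.2.1 hmem.2.2.1 hmem.2.2.2
    · congr 1
      ext s
      simp only [Set.mem_ofPred_eq, h.oppositeType_iff ht]
      refine ⟨fun hs => ⟨hs, fun r h1 h2 h3 h4 => ?_⟩, fun hs => hs.1⟩
      exact absurd ⟨r, (hneg r).2 ⟨h1, h2, h3, h4⟩⟩ hne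
  rw [this]
  obtain ⟨s, -, hs1, hs2⟩ := exists_hasType_lt ht
  exact ⟨Nat.sInf_mem ⟨s, hs1, fun r h1 _ _ h2 => hs2 r h1 h2⟩, fun s hs => Nat.sInf_le hs⟩

theorem IsEnumeration.crossedNeg_lt (h : IsEnumeration σ a e E) {t : ℕ}
    (ht : Turns e (arrow σ a) t) : crossedNeg σ a e sg t < t := by
  obtain ⟨s, hst, hs1, hs2⟩ := exists_hasType_lt ht
  exact ((h.isLeast_crossedNeg ht).2 ⟨hs1, fun r h1 _ _ h2 => hs2 r h1 h2⟩).trans_lt hst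

theorem intervalValue_eq {s t : ℕ} (hst : s ≤ t) :
    intervalValue σ a s t = root (phi σ a s) (phi σ a t) := by
  unfold intervalValue
  induction t, hst using Nat.le_induction with
  | base => simp [root]
  | succ t hst ih => rw [Finset.sum_Ico_succ_top hst, ih, beta, root_add_root]

/-- The root joining the points of an edge with the indices `p.1` and `p.2`. -/
def rootAt (σ : Bool → Equiv.Perm ℕ) (a : ℕ) (p : ℕ × ℕ) : ℕ → ℤ :=
  root (phi σ a p.1) (phi σ a p.2)

/-- Interval sums telescope, so adjoining the interval to the marked root moves just one end of its
arc to the crossed point. -/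
theorem IsEnumeration.betaStar_eq (h : IsEnumeration σ a e E)
    (hsign : ∀ t, IsInternalTurning σ a e t → sg t = 1 ∨ sg t = -1) {i : ℕ} (h1 : 1 ≤ i)
    (hi : i < e) : betaStar σ a e sg i = rootAt σ a (newArc e (arrow σ a) (fun t => sg t = -1)
      (crossedNeg σ a e sg) (crossedPos σ a e) i) := by
  have hpos : (IsInternalTurning σ a e (i + 1) ∧ sg (i + 1) = 1) ↔
      Turns e (arrow σ a) (i + 1) ∧ ¬ sg (i + 1) = -1 := by
    rw [h.isInternalTurning_iff]
    refine and_congr_right fun ht => ?_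
    have := hsign _ ((h.isInternalTurning_iff _).2 ht)
    omega
  unfold betaStar newArc rootAt
  rw [h.isInternalTurning_iff]
  split_ifs with h2 h3 h4 h4
  · rw [← h.eps_smul_root h1 hi, intervalValue_eq (h.crossedNeg_lt h2.1).le, beta, add_comm,
      root_add_root]
  · rw [← h.eps_smul_root h1 hi, intervalValue_eq (h.isLeast_crossedPos h4.1).1.1.le, beta,
      root_add_root]
  · exact absurd (hpos.1 h3) h4
  · exact absurd (hpos.2 h4) h3
  · rw [← h.eps_smul_root h1 hi, beta]

theorem IsEnumeration.before_of_hasType (h : IsEnumeration σ a e E) {b : Bool} {t : ℕ}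
    (ht : HasType e (arrow σ a) b t) (c : Bool) (hne : σ c (phi σ a t) ≠ phi σ a t) :
    Before (c == b) (phi σ a t) (σ c (phi σ a t)) := by
  rcases h.sigma_phi ⟨ht.1, ht.2.1⟩ c with ⟨rfl, h2, h3⟩ | ⟨rfl, h2, h3⟩ | h3
  · rw [h3, ← ht.2.2.1 h2]
    exact h.before_arrow ht.1 h2
  · obtain ⟨k, rfl⟩ : ∃ k, t = k + 1 := ⟨t - 1, by omega⟩
    rw [h3]
    have h4 := ht.2.2.2 h2
    rw [Nat.add_sub_cancel] at h4 ⊢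
    have := h.before_arrow (i := k) (by omega) (by have := ht.2.1; omega)
    rwa [h4, beq_not, before_not] at this
  · exact absurd h3 hne

theorem IsEnumeration.sigma_ne_of_turns (h : IsEnumeration σ a e E) {t : ℕ}
    (ht : Turns e (arrow σ a) t) (c : Bool) : σ c (phi σ a t) ≠ phi σ a t := by
  have h1 := ht.1
  have h2 := ht.2.1
  rcases Bool.eq_or_eq_not c (stepSide σ a t) with rfl | rfl
  · rw [← phi_succ h1.le]
    exact h.phi_ne ⟨by omega, by omega⟩ ⟨by omega, by omega⟩ (by omega)
  · obtain ⟨k, rfl⟩ : ∃ k, t = k + 1 := ⟨t - 1, by omega⟩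
    rw [stepSide_succ, Bool.not_not, phi_pred h.involutive (by omega)]
    exact h.phi_ne ⟨by omega, by omega⟩ ⟨by omega, by omega⟩ (by omega)

theorem IsEnumeration.exists_sigma_ne (h : IsEnumeration σ a e E) {t : ℕ} (ht : 1 ≤ t ∧ t ≤ e) :
    ∃ c, σ c (phi σ a t) ≠ phi σ a t := by
  have := h.one_lt
  rcases Nat.lt_or_ge t e with hlt | hle
  · refine ⟨stepSide σ a t, ?_⟩
    rw [← phi_succ ht.1]
    exact h.phi_ne ⟨by omega, by omega⟩ ⟨by omega, by omega⟩ (by omega)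
  · obtain ⟨k, rfl⟩ : ∃ k, t = k + 1 := ⟨t - 1, by omega⟩
    refine ⟨stepSide σ a k, ?_⟩
    rw [phi_pred h.involutive (by omega)]
    exact h.phi_ne ⟨by omega, by omega⟩ ⟨by omega, by omega⟩ (by omega)

end

/-! ### Straightening -/

section

variable {n : ℕ} {J : Bool → Finpartition (Finset.Icc 1 n)} {M : Bool → Set ℕ}
  {σ : Bool → Equiv.Perm ℕ} {a e : ℕ} {E : Set ℕ} {sg : ℕ → ℤ}

theorem samePart_sigma (hJ : ∀ b, IsConnectedPartition (J b)) (hM : IsMarking J M)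
    (hσ : ∀ b, IsModifiedInvolution (J b) (M b) (σ b)) {x : ℕ} (hx : x ∈ Set.Icc 1 n) (b : Bool) :
    SamePart (J b) x (σ b x) := by
  obtain ⟨p, q, hpq, hxp⟩ := exists_part (hJ b) (Finset.mem_Icc.2 hx)
  exact ⟨p, q, hpq, hxp, (modified_bounds (hM.isArc b) (hσ b) hpq hxp).1⟩

theorem IsEnumeration.phi_mem (h : IsEnumeration σ a e E) {t : ℕ} (ht : 1 ≤ t ∧ t ≤ e) :
    phi σ a t ∈ E :=
  h.image_eq ▸ ⟨t, ht, rfl⟩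

theorem IsEnumeration.before_of_samePart (h : IsEnumeration σ a e E)
    (hJ : ∀ b, IsConnectedPartition (J b)) (hM : IsMarking J M)
    (hσ : ∀ b, IsModifiedInvolution (J b) (M b) (σ b)) {b : Bool} {t s : ℕ}
    (ht : Turns e (arrow σ a) t) (hs : HasType e (arrow σ a) (!arrow σ a t) s)
    (hS : SamePart (J b) (phi σ a t) (phi σ a s)) :
    Before (b == arrow σ a t) (phi σ a t) (phi σ a s) := by
  have hst : t ≠ s := by
    rintro rfl
    have := hs.eq ht.2.1
    simp at this
  refine before_of_opposite hJ hM hσ hS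
    (fun c => h.before_of_hasType (hasType_of_turns ht) c (h.sigma_ne_of_turns ht c))
    (fun c hc => ?_) (h.exists_sigma_ne ⟨hs.1, hs.2.1⟩)
    (h.phi_ne ⟨ht.1.le, ht.2.1.le⟩ ⟨hs.1, hs.2.1⟩ hst)
  have := h.before_of_hasType hs c hc
  rwa [beq_not, before_not] at this

theorem IsEnumeration.isNil_beta_iff (h : IsEnumeration σ a e E) (hEn : E ⊆ Set.Icc 1 n)
    (hJ : ∀ b, IsConnectedPartition (J b)) {i : ℕ} (h1 : 1 ≤ i) (hi : i < e) :
    IsNil J (beta σ a i) ↔ ∃ c, ¬ SamePart (J c) (phi σ a i) (phi σ a (i + 1)) :=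
  isNil_root_iff hJ (hEn (h.phi_mem ⟨h1, hi.le⟩)) (hEn (h.phi_mem ⟨by omega, hi⟩))
    (h.phi_ne ⟨h1, hi.le⟩ ⟨by omega, hi⟩ (by omega))

theorem IsEnumeration.not_isNil_of_neg (h : IsEnumeration σ a e E) (hsg : IsSignature J σ a e sg)
    {t : ℕ} (ht : Turns e (arrow σ a) t) (hN : sg t = -1) : ¬ IsNil J (beta σ a t) := by
  intro hnil
  have ht' := (h.isInternalTurning_iff t).2 ht
  have : sg t = 1 := by
    by_cases h1 : IsNil J (beta σ a (t - 1))
    · exact hsg.both t ht' h1 hnil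
    · exact hsg.lower t ht' h1 hnil
  omega

/-- Two neighbouring internal turning points are joined by a nil root. -/
theorem IsEnumeration.isNil_beta_of_turns (h : IsEnumeration σ a e E) (hEn : E ⊆ Set.Icc 1 n)
    (hJ : ∀ b, IsConnectedPartition (J b)) (hM : IsMarking J M)
    (hσ : ∀ b, IsModifiedInvolution (J b) (M b) (σ b)) {t : ℕ} (ht : Turns e (arrow σ a) t)
    (ht' : Turns e (arrow σ a) (t + 1)) : IsNil J (beta σ a t) := by
  rw [h.isNil_beta_iff hEn hJ ht.1.le ht.2.1]
  by_contra hS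
  push Not at hS
  have hty := hasType_of_turns ht'
  have hd : arrow σ a (t + 1) = !arrow σ a t := by
    have := ht'.2.2
    rw [Nat.add_sub_cancel] at this
    revert this; cases arrow σ a t <;> cases arrow σ a (t + 1) <;> simp
  rw [hd] at hty
  -- The order forced on the side not containing the arc is opposite to the direction of the arc
  -- itself.
  have h1 := h.before_of_samePart hJ hM hσ ht hty (hS (!stepSide σ a t))
  rw [not_beq, before_not] at h1
  exact h1.asymm (h.before_arrow ht.1.le ht.2.1)

/-- Beyond a turning point, an edge which leaves a part does not return to it before the next
turning point. -/
theorem IsEnumeration.before_crossedPos (h : IsEnumeration σ a e E) (hEn : E ⊆ Set.Icc 1 n)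
    (hJ : ∀ b, IsConnectedPartition (J b)) (hM : IsMarking J M)
    (hσ : ∀ b, IsModifiedInvolution (J b) (M b) (σ b)) {t : ℕ} (ht : Turns e (arrow σ a) t)
    {b : Bool} (hb : stepSide σ a t = !b)
    (hS : ¬ SamePart (J b) (phi σ a t) (phi σ a (t + 1))) :
    Before (b == arrow σ a t) (phi σ a (crossedPos σ a e t)) (phi σ a t) := by
  have hcp := h.isLeast_crossedPos ht
  have hte := ht.2.1
  have ht1 := ht.1
  have hle := hcp.1.2.2.1
  -- Along the straight run, steps on side `b` stay in a part different from that of `φ(t)`, so they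
  -- cannot jump over it. Steps on the other side move further away from `φ(t)`.
  have key : ∀ k, t + 1 ≤ k → k ≤ crossedPos σ a e t → arrow σ a (k - 1) = arrow σ a t ∧
      ¬ SamePart (J b) (phi σ a t) (phi σ a k) ∧
        Before (b == arrow σ a t) (phi σ a k) (phi σ a t) := by
    intro k hk
    induction k, hk using Nat.le_induction with
    | base =>
      intro _
      refine ⟨by simp, hS, ?_⟩
      have := h.before_arrow ht1.le hte
      rwa [hb, not_beq, before_not] at this
    | succ k hk ih =>
      intro hkc
      obtain ⟨ih1, ih2, ih3⟩ := ih (by omega)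
      have hak : arrow σ a k = arrow σ a t := by
        by_contra hne
        have hty : HasType e (arrow σ a) (!arrow σ a t) k :=
          ⟨by omega, by omega, fun _ => by
            revert hne; cases arrow σ a k <;> cases arrow σ a t <;> simp,
            fun _ => by simpa using ih1⟩
        have := hcp.2 ⟨by omega, hty⟩
        omega
      rw [Nat.add_sub_cancel]
      have hbk := h.before_arrow (i := k) (by omega) (by omega)
      rw [hak] at hbk
      have htn := hEn (h.phi_mem (t := t) ⟨by omega, by omega⟩)
      have hkn := hEn (h.phi_mem (t := k) ⟨by omega, by omega⟩)
      refine ⟨hak, ?_⟩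
      rcases Bool.eq_or_eq_not (stepSide σ a k) b with hs | hs
      · have hSk : SamePart (J b) (phi σ a k) (phi σ a (k + 1)) := by
          rw [phi_succ (by omega), hs]
          exact samePart_sigma hJ hM hσ hkn b
        have hS' : ¬ SamePart (J b) (phi σ a t) (phi σ a (k + 1)) :=
          fun hS' => ih2 (hS'.trans hSk.symm)
        refine ⟨hS', ?_⟩
        rcases before_or (x := phi σ a (k + 1)) (y := phi σ a t) (b == arrow σ a t)
          (h.phi_ne ⟨by omega, by omega⟩ ⟨by omega, by omega⟩ (by omega)) with h1 | h1
        · exact h1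
        · exact absurd (hSk.of_between ih3 h1).symm ih2
      · rw [hs, not_beq] at hbk
        refine ⟨fun hS' => ih2 (hS'.of_between ((before_not _ _ _).2 ih3) hbk), ?_⟩
        rw [before_not] at hbk
        exact hbk.trans ih3
  exact (key _ hcp.1.1 le_rfl).2.2

/-- If `z` has the type opposite to the internal turning point `x` and `y` is a neighbour of `x`
then the root joining `y` and `z` lies in `K`, unless the root joining `x` and `y` is nil. -/
theorem IsEnumeration.rootAt_mem_rootsK (h : IsEnumeration σ a e E) (hEn : E ⊆ Set.Icc 1 n)
    (hJ : ∀ b, IsConnectedPartition (J b)) (hM : IsMarking J M)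
    (hσ : ∀ b, IsModifiedInvolution (J b) (M b) (σ b)) {t s k : ℕ} (ht : Turns e (arrow σ a) t)
    (hs : HasType e (arrow σ a) (!arrow σ a t) s) (hk : 1 ≤ k ∧ k ≤ e) (hks : s ≠ k) {b : Bool}
    (hb : phi σ a k = σ b (phi σ a t))
    (hpath : ¬ SamePart (J !b) (phi σ a t) (phi σ a k) →
      ¬ Before (b == arrow σ a t) (phi σ a t) (phi σ a s)) :
    rootAt σ a (orient (arrow σ a t) (s, k)) ∈ rootsK J := by
  have hsn := hEn (h.phi_mem ⟨hs.1, hs.2.1⟩)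
  have hkn := hEn (h.phi_mem hk)
  have hne := h.phi_ne ⟨hs.1, hs.2.1⟩ hk hks
  have hO := fun c => h.before_of_samePart hJ hM hσ (b := c) ht hs
  have hSb : SamePart (J b) (phi σ a t) (phi σ a k) := by
    rw [hb]
    exact samePart_sigma hJ hM hσ (hEn (h.phi_mem ⟨ht.1.le, ht.2.1.le⟩)) b
  have hxy : Before (b == arrow σ a t) (phi σ a t) (phi σ a k) := by
    rw [hb]
    exact h.before_of_hasType (hasType_of_turns ht) b (h.sigma_ne_of_turns ht b)
  have hO' : Before (b == arrow σ a t) (phi σ a t) (phi σ a s) →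
      ¬ SamePart (J !b) (phi σ a t) (phi σ a s) := by
    intro h1 h2
    have := hO (!b) h2
    rw [not_beq, before_not] at this
    exact this.asymm h1
  -- With $x,y,z$ at indices `t`, `k`, `s`, a common part of $y$ and $z$ forces $x$ before $z$ in
  -- the order of side `b`. If $x,y$ also share a part on the other side, so do $x,z$, and the order
  -- forced there is the reverse; otherwise `hpath` applies.
  have key : ∀ c, Before (c == arrow σ a t) (phi σ a s) (phi σ a k) →
      ¬ SamePart (J c) (phi σ a s) (phi σ a k) := by
    intro c hc hSc
    rcases Bool.eq_or_eq_not c b with rfl | rfl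
    · have h1 := hO c (hSb.trans hSc.symm)
      exact hpath (fun h2 => hO' h1 (h2.of_between h1 hc)) h1
    · rw [not_beq, before_not] at hc
      have h1 := hxy.trans hc
      exact hpath (fun h2 => hO' h1 (h2.trans hSc.symm)) h1
  unfold rootAt orient
  cases hd : arrow σ a t <;> simp only [hd] at key
  · refine (root_mem_rootsK_iff hJ hkn hsn hne.symm).2 fun c hc hS => key c ?_ hS.symm
    simpa [before_not] using hc
  · refine (root_mem_rootsK_iff hJ hsn hkn hne).2 fun c hc => key c ?_
    simpa using hc

theorem IsEnumeration.betaStar_mem_rootsK (h : IsEnumeration σ a e E) (hEn : E ⊆ Set.Icc 1 n)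
    (hJ : ∀ b, IsConnectedPartition (J b)) (hM : IsMarking J M)
    (hσ : ∀ b, IsModifiedInvolution (J b) (M b) (σ b)) (hsg : IsSignature J σ a e sg) {i : ℕ}
    (h1 : 1 ≤ i) (hi : i < e) (hne : betaStar σ a e sg i ≠ eps σ a i • beta σ a i) :
    betaStar σ a e sg i ∈ rootsK J := by
  rw [h.betaStar_eq hsg.sign h1 hi] at hne ⊢
  unfold newArc at hne ⊢
  split_ifs at hne ⊢ with h2 h3
  · obtain ⟨ht, hN⟩ := h2
    have hlt := h.crossedNeg_lt (sg := sg) ht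
    refine h.rootAt_mem_rootsK hEn hJ hM hσ ht (h.isLeast_crossedNeg ht).1.1 ⟨by omega, hi⟩
      (by omega) (phi_succ h1) fun hS => ?_
    -- A negative signature marks a root that is not nil, so its ends share parts on both sides.
    exact absurd ((h.isNil_beta_iff hEn hJ h1 hi).2 ⟨_, hS⟩) (h.not_isNil_of_neg hsg ht hN)
  · obtain ⟨ht, hN⟩ := h3
    have hd : arrow σ a i = !arrow σ a (i + 1) := (hasType_of_turns ht).2.2.2 ht.1
    have hcp := (h.isLeast_crossedPos ht).1
    have hgt := hcp.1
    rw [hd, orient_not_mk]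
    refine h.rootAt_mem_rootsK hEn hJ hM hσ ht hcp.2 ⟨h1, hi.le⟩ (by omega)
      (phi_pred h.involutive h1).symm fun hS hB => ?_
    have hnil : IsNil J (beta σ a i) := (h.isNil_beta_iff hEn hJ h1 hi).2 ⟨_, fun hc => hS hc.symm⟩
    -- Positive signature with a nil marked root occurs only when both roots at the turning point
    -- are nil.
    have hnil' : IsNil J (beta σ a (i + 1)) := by
      by_contra hc
      exact hN (hsg.upper (i + 1) ((h.isInternalTurning_iff _).2 ht) hnil hc)
    obtain ⟨c, hc⟩ := (h.isNil_beta_iff hEn hJ (by omega) ht.2.1).1 hnil'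
    have hside : stepSide σ a (i + 1) = !stepSide σ a i := stepSide_succ i
    -- An arc never leaves the part on its own side, so the next arc leaves a part on the side of
    -- arc `i`.
    have hc' : c = stepSide σ a i := by
      rcases Bool.eq_or_eq_not c (stepSide σ a i) with hcs | hcs
      · exact hcs
      · refine absurd ?_ hc
        rw [hcs, ← hside, phi_succ (t := i + 1) (by omega)]
        exact samePart_sigma hJ hM hσ (hEn (h.phi_mem ⟨by omega, hi⟩)) _
    rw [hc'] at hc
    exact hB.asymm (h.before_crossedPos hEn hJ hM hσ ht hside hc)
  · exact absurd (h.eps_smul_root h1 hi i (i + 1)).symm hne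

/-! ### Transport of the straightened list to the edge. -/

theorem links_map (f : ℕ → ℕ) (L : List ℕ) : links (L.map f) = Prod.map f f '' links L := by
  induction L with
  | nil => simp [links]
  | cons x L ih =>
    cases L with
    | nil => simp [links]
    | cons y L =>
      simp only [List.map_cons, links, Set.image_insert_eq, Prod.map_apply] at ih ⊢
      rw [ih]

/-- The new arcs of an edge join the consecutive points of a list. -/
theorem IsEnumeration.exists_list (h : IsEnumeration σ a e E) (hEn : E ⊆ Set.Icc 1 n)
    (hJ : ∀ b, IsConnectedPartition (J b)) (hM : IsMarking J M)
    (hσ : ∀ b, IsModifiedInvolution (J b) (M b) (σ b)) (hsg : IsSignature J σ a e sg) :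
    ∃ L : List ℕ, L.Nodup ∧ {x | x ∈ L} = E ∧ L.length = e ∧ linkRoots L = PiStar σ a e sg ∧
      ∀ i ∈ Set.Ico 1 e, eps σ a i • beta σ a i ∈ natSpan (linkRoots L) := by
  obtain ⟨L, hnd, hmem, hlinks, hord⟩ := exists_list_links_eq h.one_lt
    (d := arrow σ a) (N := fun t => sg t = -1) (cn := crossedNeg σ a e sg) (cp := crossedPos σ a e)
    (fun t ht _ => h.isLeast_crossedNeg ht) (fun t ht _ => h.isLeast_crossedPos ht)
    -- Two consecutive turning points are joined by a nil root, whereas negative signature at the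
    -- first requires that root not to be nil; the proviso on signatures holds vacuously.
    (fun t ht hN ht' => absurd (h.isNil_beta_of_turns hEn hJ hM hσ ht ht')
      (h.not_isNil_of_neg hsg ht hN))
  have hinj : ∀ x ∈ L, ∀ y ∈ L, phi σ a x = phi σ a y → x = y := fun x hx y hy heq =>
    h.injOn ((hmem x).1 hx) ((hmem y).1 hy) heq
  refine ⟨L.map (phi σ a), hnd.map_on hinj, ?_, ?_, ?_, ?_⟩
  · rw [← h.image_eq]
    ext x
    simp [hmem]
  · have : L.toFinset = Finset.Icc 1 e := by
      ext x; simp [hmem]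
    rw [List.length_map, ← List.toFinset_card_of_nodup hnd, this]
    simp
  · rw [linkRoots, links_map, hlinks, PiStar, Set.image_image, Set.image_image]
    exact Set.image_congr fun i hi => (h.betaStar_eq hsg.sign hi.1 hi.2).symm
  · rintro i ⟨h1, hi⟩
    have := hord i h1 hi
    rw [beta, h.eps_smul_root h1 hi]
    apply root_mem_natSpan_of_sublist
    cases hd : arrow σ a i <;> simp only [hd] at this
    · exact this.map (phi σ a)
    · exact this.map (phi σ a)

/-- Points outside `[1, n]` are fixed by both involutions, so their meanders are singletons. -/
theorem edge_subset (hσ : ∀ b, IsModifiedInvolution (J b) (M b) (σ b))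
    (hE : IsMeander (σ true) (σ false) E) (hnt : E.Nontrivial) : E ⊆ Set.Icc 1 n := by
  obtain ⟨x, rfl⟩ := hE
  have hmul : ∀ b, σ b * σ b = 1 := fun b => Equiv.ext (hσ b).involutive
  by_cases hx : x ∈ Set.Icc 1 n
  · have hst : ∀ b, ∀ y ∈ Set.Icc 1 n, σ b y ∈ Set.Icc 1 n := by
      intro b y hy
      by_contra hc
      have h1 := (hσ b).outside _ hc
      rw [(hσ b).involutive] at h1
      exact hc (h1 ▸ hy)
    exact orbit_subset_of_stable (hmul true) (hmul false) (hst true) (hst false) hx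
  · have hst : ∀ b, ∀ y ∈ ({x} : Set ℕ), σ b y ∈ ({x} : Set ℕ) := by
      rintro b y rfl
      exact (hσ b).outside _ hx
    have := orbit_subset_of_stable (hmul true) (hmul false) (hst true) (hst false)
      (Set.mem_singleton x)
    exact absurd (Set.subsingleton_singleton.anti this) (Set.not_subsingleton_iff.2 hnt)

end

end Straightening

theorem proposition6p7 (n : ℕ) (hn : 1 < n)
    (J : Bool → Finpartition (Finset.Icc 1 n))
    (hJ : ∀ b, IsConnectedPartition (J b))
    (hcup : simpleIndices (J true) ∪ simpleIndices (J false) = Set.Ico 1 n)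
    (hcap : simpleIndices (J true) ∩ simpleIndices (J false) ≠ Set.Ico 1 n)
    (M : Bool → Set ℕ) (hM : IsMarking J M)
    (σ : Bool → Equiv.Perm ℕ) (hσ : ∀ b, IsModifiedInvolution (J b) (M b) (σ b))
    (E : Set ℕ) (hE : IsEdge (σ true) (σ false) E) (hnt : E.Nontrivial)
    (a : ℕ) (ha : a ∈ E) (hfix : σ true a = a ∨ σ false a = a)
    (sg : ℕ → ℤ) (hsg : IsSignature J σ a E.ncard sg) :
    IsSimpleSystem (rootsOn E) (PiStar σ a E.ncard sg) ∧
    IsOfTypeA n (E.ncard - 1) (PiStar σ a E.ncard sg) ∧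
    (fun i => eps σ a i • beta σ a i) '' Set.Ico 1 E.ncard = rootsSOn σ E ∧
    (∀ i ∈ Set.Ico 1 E.ncard, eps σ a i • beta σ a i ∈ natSpan (PiStar σ a E.ncard sg)) ∧
    (∀ i ∈ Set.Ico 1 E.ncard, betaStar σ a E.ncard sg i ≠ eps σ a i • beta σ a i →
      betaStar σ a E.ncard sg i ∈ rootsK J) := by
  have hEn := edge_subset hσ hE.1 hnt
  have h : IsEnumeration σ a E.ncard E := isEnumeration_of_edge (fun b => (hσ b).involutive) hE.1
    ((Set.finite_Icc 1 n).subset hEn) hnt ha hfix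
  obtain ⟨L, hnd, hmem, hlen, hL, hspan⟩ := h.exists_list hEn hJ hM hσ hsg
  refine ⟨?_, ?_, h.image_eps_smul_beta, ?_, fun i hi hne =>
    h.betaStar_mem_rootsK hEn hJ hM hσ hsg hi.1 hi.2 hne⟩
  · have := isSimpleSystem_linkRoots hnd
    rwa [hmem, hL] at this
  · have := isOfTypeA_linkRoots (n := n) hnd fun x hx =>
      Finset.mem_Icc.2 (hEn (hmem ▸ hx : x ∈ E))
    rwa [hlen, hL] at this
  · rwa [hL] at hspan
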